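/- Let $M$ be a smooth manifold without boundary, modelled on a real Banach space $E$ (finite- or infinite-dimensional), and let $p:T^*M\to M$ be its cotangent bundle, whose fibre over $x$ is the space of continuous linear forms on $T_xM$. Let $\theta$ be the Liouville form, $\theta_\alpha(Y)=\langle\alpha,Tp\,Y\rangle$, and $\omega=-d\theta$ the canonical symplectic form. Let $B$ be a smooth closed 2-form on $M$ and $\omega_B=\omega+p^*B$ the twisted symplectic form. A Hamiltonian vector field of $F\in C^\infty(T^*M)$ is a smooth vector field $X_F$ on $T^*M$ with $i_{X_F}\omega_B=dF$. Let $C^\infty(T^*M)_B\subseteq C^\infty(T^*M)$ be the linear subspace of the functions that have a Hamiltonian vector field. On it the Poisson bracket is $\{F,G\}_B=\omega_B(X_G,X_F)$ $(=dG(X_F))$. Then: 1. The bracket $[v+f,w+g]=[v,w]+L_vg-L_wf+B(v,w)$ makes $\mathfrak X(M)\oplus C^\infty(M)$ a real Lie algebra, the abelian extension $\mathfrak X(M)\ltimes_BC^\infty(M)$. 2. $\{\ ,\ \}_B$ takes values in $C^\infty(T^*M)_B$ and makes it a real Lie algebra. If $E$ is finite-dimensional, then $C^\infty(T^*M)_B=C^\infty(T^*M)$.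 3. The linear map $\Phi:\mathfrak X(M)\ltimes_BC^\infty(M)\to C^\infty(T^*M)$, $\Phi(v+f)=\mathrm{ev}_v+p^*f$, where $\mathrm{ev}_v(\alpha)=\langle\alpha,v(p(\alpha))\rangle$, takes values in $C^\infty(T^*M)_B$ and is an injective Lie algebra homomorphism: $\Phi([a,b])=\{\Phi(a),\Phi(b)\}_B$ for all $a,b$. -/

import Mathlib

open Bundle
open scoped Manifold ContDiff Topology

noncomputable section

namespace TwistedCotangent

section Forms

variable {E : Type*} [NormedAddCommGroup E] [NormedSpace ℝ E]
  {H : Type*} [TopologicalSpace H] (I : ModelWithCorners ℝ E H)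
  (M : Type*) [TopologicalSpace M] [ChartedSpace H M]
  {E' : Type*} [NormedAddCommGroup E'] [NormedSpace ℝ E']
  {H' : Type*} [TopologicalSpace H'] (I' : ModelWithCorners ℝ E' H')
  {M' : Type*} [TopologicalSpace M'] [ChartedSpace H' M']

/-- A field of alternating `k`-forms on the tangent spaces of `M`
(a differential `k`-form, before smoothness is imposed). -/
abbrev DForm (k : ℕ) : Type _ := (x : M) → TangentSpace I x [⋀^Fin k]→L[ℝ] ℝ

variable {I M I'}

/-- The pullback `f^* η`. -/
def DForm.pullback {k : ℕ} (f : M' → M) (η : DForm I M k) : DForm I' M' k :=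
  fun y => (η (f y)).compContinuousLinearMap (mfderiv I' I f y)

/-- The expression of `η` in the chart at `x₀`, a form on the model vector space
(meaningful on the target of the chart; all manifolds below are without boundary, so that
this target is open). -/
def DForm.inChart {k : ℕ} (η : DForm I M k) (x₀ : M) : E → E [⋀^Fin k]→L[ℝ] ℝ :=
  DForm.pullback (I' := 𝓘(ℝ, E)) (extChartAt I x₀).symm η

/-- `η` is smooth: its expression in the chart at each point is smooth on the
target of that chart. -/
def DForm.IsSmooth {k : ℕ} (η : DForm I M k) : Prop :=
  ∀ x₀ : M, ContDiffOn ℝ ∞ (η.inChart x₀) (extChartAt I x₀).target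

/-- The exterior derivative, computed at `x` in the chart at `x`. -/
def DForm.d {k : ℕ} (η : DForm I M k) : DForm I M (k + 1) := fun x =>
  (extDeriv (η.inChart x) (extChartAt I x x)).compContinuousLinearMap
    (mfderiv I 𝓘(ℝ, E) (extChartAt I x) x)

end Forms

section Lie

/-- `br` makes the real vector space `V` into a Lie algebra. -/
structure IsLieBracket {V : Type*} [AddCommGroup V] [Module ℝ V] (br : V → V → V) : Prop where
  add_left : ∀ a b c, br (a + b) c = br a c + br b c
  smul_left : ∀ (r : ℝ) a b, br (r • a) b = r • br a b
  add_right : ∀ a b c, br a (b + c) = br a b + br a c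
  smul_right : ∀ (r : ℝ) a b, br a (r • b) = r • br a b
  self : ∀ a, br a a = 0
  jacobi : ∀ a b c, br a (br b c) + br b (br c a) + br c (br a b) = 0

end Lie

section VectorFields

variable {E : Type*} [NormedAddCommGroup E] [NormedSpace ℝ E]
  {H : Type*} [TopologicalSpace H] (I : ModelWithCorners ℝ E H)
  (M : Type*) [TopologicalSpace M] [ChartedSpace H M] [IsManifold I ∞ M]

/-- Smooth vector fields on `M`. -/
abbrev VField : Type _ := Cₛ^∞⟮I; E, (TangentSpace I : M → Type _)⟯

/-- Smooth real functions on `M`. -/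
abbrev SFun : Type _ := C^∞⟮I, M; 𝓘(ℝ, ℝ), ℝ⟯

variable {I M}

/-- The Lie bracket `[v, w]` of smooth vector fields. -/
def VField.bracket [CompleteSpace E] (v w : VField I M) : VField I M :=
  ⟨VectorField.mlieBracket I v w, by
    have : IsManifold I (((⊤ : ℕ∞) : WithTop ℕ∞) + 1) M := inferInstanceAs (IsManifold I ∞ M)
    have : IsManifold I (minSmoothness ℝ 2) M := by
      rw [minSmoothness_of_isRCLikeNormedField]; infer_instance
    exact ContDiff.mlieBracket_vectorField (I := I) (m := ⊤) (n := ⊤) v.contMDiff w.contMDiff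
      (by simp)⟩

/-- The derivative `L_v f` of `f` along `v`. -/
def SFun.lieDeriv (v : VField I M) (f : SFun I M) : SFun I M :=
  ⟨fun x => mfderiv I 𝓘(ℝ, ℝ) f x (v x), by
    have h1 : ContMDiff I.tangent 𝓘(ℝ, ℝ).tangent ∞ (tangentMap I 𝓘(ℝ, ℝ) f) :=
      f.contMDiff.contMDiff_tangentMap (by simp)
    have h2 := h1.comp v.contMDiff
    intro x
    have h3 := (Bundle.contMDiffAt_totalSpace.1 (h2 x)).2
    simpa using h3⟩

theorem contMDiffAt_mfderiv_extChartAt (v : VField I M) (x₀ : M) :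
    ContMDiffAt I 𝓘(ℝ, E) ∞
      (fun x => (show E from mfderiv I 𝓘(ℝ, E) (extChartAt I x₀) x (v x))) x₀ := by
  have h := (contMDiffAt_section x₀).1 (v.contMDiff x₀)
  refine h.congr_of_eventuallyEq ?_
  filter_upwards [(chartAt H x₀).open_source.mem_nhds (mem_chart_source H x₀)] with x hx
  rw [TangentBundle.trivializationAt_apply, (hasMFDerivAt_extChartAt hx).mfderiv,
    mfderiv_chartAt_eq_tangentCoordChange hx]
  rfl

theorem DForm.eq_inChart [I.Boundaryless] (η : DForm I M 2) (x₀ x : M)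
    (hx : x ∈ (extChartAt I x₀).source) (a b : TangentSpace I x) :
    η x ![a, b] = η.inChart x₀ (extChartAt I x₀ x)
      ![mfderiv I 𝓘(ℝ, E) (extChartAt I x₀) x a, mfderiv I 𝓘(ℝ, E) (extChartAt I x₀) x b] := by
  have h := mfderivWithin_extChartAt_symm_comp_mfderiv_extChartAt' hx
  rw [I.range_eq_univ, mfderivWithin_univ] at h
  have key : ∀ (z : M) (_ : z = x) (L : E →L[ℝ] TangentSpace I z),
      (∀ c : TangentSpace I x,
        (L (mfderiv I 𝓘(ℝ, E) (extChartAt I x₀) x c) : E) = (c : E)) →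
      η x ![a, b] = (η z).compContinuousLinearMap L
        ![mfderiv I 𝓘(ℝ, E) (extChartAt I x₀) x a,
          mfderiv I 𝓘(ℝ, E) (extChartAt I x₀) x b] := by
    rintro z rfl L hL
    rw [ContinuousAlternatingMap.compContinuousLinearMap_apply]
    congr 1
    funext i
    fin_cases i
    · exact (hL a).symm
    · exact (hL b).symm
  exact key _ ((extChartAt I x₀).left_inv hx) _ (fun c => DFunLike.congr_fun h c)

theorem contMDiffAt_eval₂ (A : M → E [⋀^Fin 2]→L[ℝ] ℝ) (u v : M → E) (x : M)
    (hA : ContMDiffAt I 𝓘(ℝ, E [⋀^Fin 2]→L[ℝ] ℝ) ∞ A x)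
    (hu : ContMDiffAt I 𝓘(ℝ, E) ∞ u x) (hv : ContMDiffAt I 𝓘(ℝ, E) ∞ v x) :
    ContMDiffAt I 𝓘(ℝ, ℝ) ∞ (fun x => A x ![u x, v x]) x := by
  let c := (continuousMultilinearCurryLeftEquiv ℝ
    (fun _ : Fin 2 => E) ℝ).toContinuousLinearEquiv.toContinuousLinearMap
  let c1 := (continuousMultilinearCurryLeftEquiv ℝ
    (fun _ : Fin 1 => E) ℝ).toContinuousLinearEquiv.toContinuousLinearMap
  let c0 := (continuousMultilinearCurryFin0 ℝ E ℝ).toContinuousLinearEquiv.toContinuousLinearMap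
  let t := ContinuousAlternatingMap.toContinuousMultilinearMapCLM ℝ
    (𝕜 := ℝ) (E := E) (F := ℝ) (ι := Fin 2)
  have h1 := ((c.comp t).contMDiff.contMDiffAt.comp x hA).clm_apply hu
  have h2 := (c1.contMDiff.contMDiffAt.comp x h1).clm_apply hv
  refine (c0.contMDiff.contMDiffAt.comp x h2).congr_of_eventuallyEq
    (Filter.Eventually.of_forall fun y => ?_)
  show A y _ = A y _
  congr 1
  funext i
  fin_cases i <;> rfl

/-- The function `η(v, w)`, for a smooth 2-form `η` and smooth vector fields `v`, `w`. -/
def DForm.eval₂ [I.Boundaryless] (η : DForm I M 2) (hη : η.IsSmooth) (v w : VField I M) :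
    SFun I M :=
  ⟨fun x => η x ![v x, w x], by
    intro x₀
    have hB : ContMDiffAt I 𝓘(ℝ, E [⋀^Fin 2]→L[ℝ] ℝ) ∞
        (fun x => η.inChart x₀ (extChartAt I x₀ x)) x₀ :=
      ((hη x₀).contDiffAt (extChartAt_target_mem_nhds x₀)).contMDiffAt.comp x₀
        contMDiffAt_extChartAt
    refine (contMDiffAt_eval₂ _ _ _ x₀ hB (contMDiffAt_mfderiv_extChartAt v x₀)
      (contMDiffAt_mfderiv_extChartAt w x₀)).congr_of_eventuallyEq ?_
    filter_upwards [extChartAt_source_mem_nhds (I := I) x₀] with x hx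
    exact η.eq_inChart x₀ x hx _ _⟩

end VectorFields

section Poisson

variable {E : Type*} [NormedAddCommGroup E] [NormedSpace ℝ E]
  {H : Type*} [TopologicalSpace H] {I : ModelWithCorners ℝ E H}
  {M : Type*} [TopologicalSpace M] [ChartedSpace H M] [IsManifold I ∞ M]

/-- `X` is a Hamiltonian vector field of `F` for the 2-form `Ω`: `i_X Ω = dF`. -/
def IsHamiltonian (Ω : DForm I M 2) (X : VField I M) (F : SFun I M) : Prop :=
  ∀ (x : M) (Y : TangentSpace I x), Ω x ![X x, Y] = mfderiv I 𝓘(ℝ, ℝ) F x Y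

theorem IsHamiltonian.add {Ω : DForm I M 2} {X X' : VField I M} {F F' : SFun I M}
    (h : IsHamiltonian Ω X F) (h' : IsHamiltonian Ω X' F') :
    IsHamiltonian Ω (X + X') (F + F') := by
  intro x Y
  have e : Ω x ![(X + X') x, Y] = Ω x ![X x, Y] + Ω x ![X' x, Y] :=
    (Ω x).toMultilinearMap.cons_add ![Y] (X x) (X' x)
  rw [e, h x Y, h' x Y, ContMDiffMap.coe_add,
    mfderiv_add F.mdifferentiableAt F'.mdifferentiableAt]
  rfl

theorem IsHamiltonian.smul {Ω : DForm I M 2} (r : ℝ) {X : VField I M} {F : SFun I M}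
    (h : IsHamiltonian Ω X F) : IsHamiltonian Ω (r • X) (r • F) := by
  intro x Y
  have e : Ω x ![(r • X) x, Y] = r * Ω x ![X x, Y] :=
    (Ω x).toMultilinearMap.cons_smul ![Y] r (X x)
  rw [e, h x Y, ContMDiffMap.coe_smul, const_smul_mfderiv F.mdifferentiableAt]
  rfl

theorem IsHamiltonian.zero (Ω : DForm I M 2) : IsHamiltonian Ω 0 0 := by
  intro x Y
  have h : mfderiv I 𝓘(ℝ, ℝ) (fun _ : M => (0 : ℝ)) x = 0 := mfderiv_const
  have e : (⇑(0 : SFun I M) : M → ℝ) = fun _ => (0 : ℝ) := rfl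
  rw [e, h]
  exact (Ω x).map_coord_zero 0 rfl

/-- The smooth functions that have a smooth Hamiltonian vector field, that is, those on which the
Poisson bracket of `Ω` is defined. For a symplectic form on a finite-dimensional manifold these are
all smooth functions; for a (weak) symplectic form on a Banach manifold they need not be. -/
def hamiltonianFunctions (Ω : DForm I M 2) : Submodule ℝ (SFun I M) where
  carrier := {F | ∃ X, IsHamiltonian Ω X F}
  add_mem' := fun ⟨X, hX⟩ ⟨X', hX'⟩ => ⟨X + X', hX.add hX'⟩
  zero_mem' := ⟨0, IsHamiltonian.zero Ω⟩
  smul_mem' := fun r _ ⟨X, hX⟩ => ⟨r • X, hX.smul r⟩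

/-- A Hamiltonian vector field of `F`. -/
def hamiltonianField (Ω : DForm I M 2) (F : hamiltonianFunctions Ω) : VField I M :=
  F.2.choose

/-- The Poisson bracket `{F, G} = Ω(X_G, X_F)`, which equals `dG(X_F) = - dF(X_G)` and so does not
depend on the choice of the Hamiltonian vector fields. -/
def poissonBracket (Ω : DForm I M 2) (F G : hamiltonianFunctions Ω) : M → ℝ := fun x =>
  Ω x ![hamiltonianField Ω G x, hamiltonianField Ω F x]

/-- The bracket `[v + f, w + g] = [v, w] + L_v g - L_w f + B(v, w)` of the extension
`𝔛(M) ⋉_B C^∞(M)`, whose underlying vector space is `𝔛(M) × C^∞(M)`. -/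
def extensionBracket [CompleteSpace E] [I.Boundaryless] (B : DForm I M 2) (hB : B.IsSmooth)
    (a b : VField I M × SFun I M) : VField I M × SFun I M :=
  (a.1.bracket b.1, b.2.lieDeriv a.1 - a.2.lieDeriv b.1 + B.eval₂ hB a.1 b.1)

end Poisson

section Cotangent

variable {E : Type*} [NormedAddCommGroup E] [NormedSpace ℝ E]
  {H : Type*} [TopologicalSpace H] (I : ModelWithCorners ℝ E H)
  (M : Type*) [TopologicalSpace M] [ChartedSpace H M] [IsManifold I ∞ M]

/-- The cotangent bundle `T^*M`: its points are pairs `α = ⟨x, ξ⟩` with `ξ` a continuous linear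
form on `T_x M`. -/
abbrev Cotangent : Type _ :=
  TotalSpace (E →L[ℝ] ℝ) (fun x : M => TangentSpace I x →L[ℝ] Bundle.Trivial M ℝ x)

/-- The model with corners of `T^*M`. -/
abbrev cotangentModel : ModelWithCorners ℝ (E × (E →L[ℝ] ℝ)) (ModelProd H (E →L[ℝ] ℝ)) :=
  I.prod 𝓘(ℝ, E →L[ℝ] ℝ)

/-- The projection `p : T^*M → M`. -/
def cotangentProj : Cotangent I M → M := fun α => α.proj

/-- The Liouville form, `θ_α(Y) = α(Tp Y)`. -/
def liouville : DForm (cotangentModel I) (Cotangent I M) 1 := fun α =>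
  ContinuousAlternatingMap.ofSubsingleton ℝ (TangentSpace (cotangentModel I) α) ℝ (0 : Fin 1)
    ((show TangentSpace I α.proj →L[ℝ] ℝ from α.snd).comp
      (show TangentSpace (cotangentModel I) α →L[ℝ] TangentSpace I α.proj from
        mfderiv (cotangentModel I) I (cotangentProj I M) α))

/-- The canonical symplectic form `-dθ` on `T^*M`. -/
def canonicalForm : DForm (cotangentModel I) (Cotangent I M) 2 := -(liouville I M).d

variable {I M}

/-- The twisted form `-dθ + p^*B` on `T^*M`. -/
def twistedForm (B : DForm I M 2) : DForm (cotangentModel I) (Cotangent I M) 2 :=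
  canonicalForm I M + B.pullback (cotangentProj I M)

variable (I M)

/-- The map `v + f ↦ ev_v + p^* f` from `𝔛(M) × C^∞(M)` to `C^∞(T^*M)`, where
`ev_v(α) = α(v(p(α)))`. -/
def evalMap : (VField I M × SFun I M) →ₗ[ℝ] SFun (cotangentModel I) (Cotangent I M) where
  toFun a := ⟨fun α => α.snd (a.1 α.proj) + a.2 α.proj, by
    have hp : ContMDiff (cotangentModel I) I ∞ (fun α : Cotangent I M => α.proj) :=
      contMDiff_proj _
    have h1 : ContMDiff (cotangentModel I) (cotangentModel I) ∞
        (fun α : Cotangent I M => (TotalSpace.mk' (E →L[ℝ] ℝ)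
          (E := fun x : M => TangentSpace I x →L[ℝ] Bundle.Trivial M ℝ x) α.proj α.snd)) :=
      contMDiff_id
    have h2 := ContMDiff.clm_bundle_apply h1 (v := fun α : Cotangent I M => a.1 α.proj)
      (a.1.contMDiff.comp hp)
    refine ContMDiff.add (fun α => ?_) (a.2.contMDiff.comp hp)
    exact (Bundle.contMDiffAt_totalSpace.1 (h2 α)).2⟩
  map_add' a b := by
    ext α
    have : α.snd (a.1 α.proj + b.1 α.proj) = α.snd (a.1 α.proj) + α.snd (b.1 α.proj) := map_add _ _ _
    change (α.snd (a.1 α.proj + b.1 α.proj) : ℝ) + (a.2 α.proj + b.2 α.proj) = (α.snd (a.1 α.proj) + a.2 α.proj) + (α.snd (b.1 α.proj) + b.2 α.proj)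
    rw [this]; exact add_add_add_comm (α.snd (a.1 α.proj) : ℝ) _ _ _
  map_smul' r a := by
    ext α
    have : α.snd (r • a.1 α.proj) = r • α.snd (a.1 α.proj) := map_smul _ _ _
    change (α.snd (r • a.1 α.proj) : ℝ) + r * a.2 α.proj = r * (α.snd (a.1 α.proj) + a.2 α.proj)
    rw [this]; exact (mul_add r (α.snd (a.1 α.proj) : ℝ) _).symm

end Cotangent

end TwistedCotangent

/-! For any closed 2-form `Ω`, if `i_X Ω = dF` and `i_Y Ω = dG`, then `[X, Y]` is a Hamiltonian
field of `dG(X)`: this is `twoForm_lieBracket` in a chart and `IsHamiltonian.bracket` on the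
manifold. Hence the bracket `{F, G} = L_{X_F} G` stays among the functions with a Hamiltonian field,
and the Jacobi identity is `L_{[X, Y]} = [L_X, L_Y]`. Nondegeneracy plays no role here: by
antisymmetry `L_{X_F} G = -L_{X_G} F`, so the choice of the fields is immaterial.

The chart of `T^*M` at `α` turns `ω_B` into the constant form of `E × E*` plus the pullback of the
expression of `B` (`twistedForm_inChart`). So `ω_B` is closed, and by Hahn-Banach it is weakly
nondegenerate. The equation `i_X ω_B = dF` can be solved exactly when the fibre derivative of `F`, a
priori in `E**`, is given by a vector of `E`; this vector is the horizontal part of `X`, and `X` is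
smooth if the vector depends smoothly on the point (`mem_hamiltonianFunctions_of_fiberDeriv`). In
finite dimension the condition always holds. For `ev_v + p^*f` the vector is `v`.

For the homomorphism property, the Hamiltonian equation of `ev_v + p^*f` is tested on `(0, η)` and
on `(w, 0)`; this gives both components of `X` that enter `L_X (ev_w + p^*g)`. Finally the extension
inherits its Lie algebra axioms from the Poisson algebra through the injective map `evalMap`. -/

namespace TwistedCotangent

/-! ### Vector fields, functions and forms in charts. -/

section Charts

variable {E : Type*} [NormedAddCommGroup E] [NormedSpace ℝ E]
  {H : Type*} [TopologicalSpace H] {I : ModelWithCorners ℝ E H}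
  {M : Type*} [TopologicalSpace M] [ChartedSpace H M]

/-- The value of a form at a point, as a form on the model space. -/
def DForm.form {k : ℕ} (η : DForm I M k) (x : M) : E [⋀^Fin k]→L[ℝ] ℝ := η x

variable (I) in
/-- The derivative at `x` of the chart at `x₀`, as an endomorphism of the model space. -/
def chartDeriv (x₀ x : M) : E →L[ℝ] E :=
  mfderiv I 𝓘(ℝ, E) (extChartAt I x₀) x

variable (I) in
/-- The derivative at `y` of the inverse of the chart at `x₀`, as an endomorphism of the model
space. -/
def chartSymmDeriv (x₀ : M) (y : E) : E →L[ℝ] E :=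
  mfderiv 𝓘(ℝ, E) I (extChartAt I x₀).symm y

section

variable [IsManifold I 1 M]

theorem chartDeriv_self (x : M) : chartDeriv I x x = ContinuousLinearMap.id ℝ E :=
  mfderiv_extChartAt_self

variable [I.Boundaryless]

theorem chartDeriv_chartSymmDeriv {x₀ x : M} (hx : x ∈ (extChartAt I x₀).source) (c : E) :
    chartDeriv I x₀ x (chartSymmDeriv I x₀ (extChartAt I x₀ x) c) = c := by
  have h := mfderiv_extChartAt_comp_mfderivWithin_extChartAt_symm' hx
  rw [I.range_eq_univ, mfderivWithin_univ] at h
  exact DFunLike.congr_fun h c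

theorem mdifferentiableAt_extChartAt_symm {x₀ : M} {y : E} (hy : y ∈ (extChartAt I x₀).target) :
    MDifferentiableAt 𝓘(ℝ, E) I (extChartAt I x₀).symm y := by
  have h := mdifferentiableWithinAt_extChartAt_symm hy
  rwa [I.range_eq_univ, mdifferentiableWithinAt_univ] at h

end

variable [IsManifold I ∞ M]

/-- The expression of a vector field in the chart at `x₀`. -/
def VField.inChart (X : VField I M) (x₀ : M) (y : E) : E :=
  chartDeriv I x₀ ((extChartAt I x₀).symm y) (X ((extChartAt I x₀).symm y))

/-- The value of a vector field at a point, as a vector of the model space. -/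
def VField.vec (X : VField I M) (x : M) : E := X x

/-- The differential of a function at a point, as a linear form on the model space. -/
def SFun.differential (F : SFun I M) (x : M) : E →L[ℝ] ℝ := mfderiv I 𝓘(ℝ, ℝ) F x

/-- The expression of a function in the chart at `x₀`. -/
def SFun.inChart (F : SFun I M) (x₀ : M) (y : E) : ℝ :=
  F ((extChartAt I x₀).symm y)

theorem VField.inChart_extChartAt (X : VField I M) {x₀ x : M}
    (hx : x ∈ (extChartAt I x₀).source) :
    X.inChart x₀ (extChartAt I x₀ x) = chartDeriv I x₀ x (X.vec x) := by
  rw [VField.inChart, (extChartAt I x₀).left_inv hx]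
  rfl

theorem VField.inChart_self (X : VField I M) (x : M) :
    X.inChart x (extChartAt I x x) = X.vec x := by
  rw [X.inChart_extChartAt (mem_extChartAt_source x), chartDeriv_self]
  rfl

variable [I.Boundaryless]

theorem contDiffAt_comp_extChartAt_symm {F : Type*} [NormedAddCommGroup F] [NormedSpace ℝ F]
    {f : M → F} {x₀ : M} {y : E} (hy : y ∈ (extChartAt I x₀).target)
    (hf : ContMDiffAt I 𝓘(ℝ, F) ∞ f ((extChartAt I x₀).symm y)) :
    ContDiffAt ℝ ∞ (fun y => f ((extChartAt I x₀).symm y)) y :=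
  (hf.comp y ((contMDiffOn_extChartAt_symm x₀).contMDiffAt
    ((isOpen_extChartAt_target x₀).mem_nhds hy))).contDiffAt

theorem SFun.contDiffAt_inChart (F : SFun I M) {x₀ : M} {y : E}
    (hy : y ∈ (extChartAt I x₀).target) : ContDiffAt ℝ ∞ (F.inChart x₀) y :=
  contDiffAt_comp_extChartAt_symm hy F.contMDiff.contMDiffAt

/-- Smoothness at the centre of the chart is enough below, since brackets and second derivatives at
`x` are always computed in the chart at `x`. -/
theorem VField.contDiffAt_inChart (X : VField I M) (x₀ : M) :
    ContDiffAt ℝ ∞ (X.inChart x₀) (extChartAt I x₀ x₀) := by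
  refine contDiffAt_comp_extChartAt_symm (mem_extChartAt_target x₀)
    (f := fun x => (show E from mfderiv I 𝓘(ℝ, E) (extChartAt I x₀) x (X x))) ?_
  rw [extChartAt_to_inv]
  exact contMDiffAt_mfderiv_extChartAt X x₀

theorem SFun.differential_eq (F : SFun I M) {x₀ x : M} (hx : x ∈ (extChartAt I x₀).source) (Y : E) :
    F.differential x Y =
      fderiv ℝ (F.inChart x₀) (extChartAt I x₀ x) (chartDeriv I x₀ x Y) := by
  have hd : MDifferentiableAt 𝓘(ℝ, E) 𝓘(ℝ, ℝ) (F.inChart x₀) (extChartAt I x₀ x) :=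
    ((F.contDiffAt_inChart ((extChartAt I x₀).map_source hx)).differentiableAt
      (by simp)).mdifferentiableAt
  have hc : MDifferentiableAt I 𝓘(ℝ, E) (extChartAt I x₀) x :=
    mdifferentiableAt_extChartAt (by rwa [extChartAt_source] at hx)
  have e : (F : M → ℝ) =ᶠ[𝓝 x] F.inChart x₀ ∘ extChartAt I x₀ := by
    filter_upwards [(isOpen_extChartAt_source x₀).mem_nhds hx] with z hz
    rw [Function.comp_apply, SFun.inChart, (extChartAt I x₀).left_inv hz]
  rw [SFun.differential, e.mfderiv_eq, mfderiv_comp x hd hc, mfderiv_eq_fderiv]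
  rfl

omit [I.Boundaryless] in
theorem SFun.lieDeriv_apply (v : VField I M) (f : SFun I M) (x : M) :
    f.lieDeriv v x = f.differential x (v.vec x) := rfl

theorem SFun.inChart_lieDeriv (v : VField I M) (f : SFun I M) {x₀ : M} {y : E}
    (hy : y ∈ (extChartAt I x₀).target) :
    (f.lieDeriv v).inChart x₀ y = fderiv ℝ (f.inChart x₀) y (v.inChart x₀ y) := by
  rw [SFun.inChart, SFun.lieDeriv_apply, f.differential_eq ((extChartAt I x₀).map_target hy),
    (extChartAt I x₀).right_inv hy]
  rfl

theorem fderiv_fderiv_apply {f : E → ℝ} {v : E → E} {y : E} (hf : ContDiffAt ℝ ∞ f y)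
    (hv : DifferentiableAt ℝ v y) (w : E) :
    fderiv ℝ (fun z => fderiv ℝ f z (v z)) y w =
      fderiv ℝ (fderiv ℝ f) y w (v y) + fderiv ℝ f y (fderiv ℝ v y w) := by
  have h : DifferentiableAt ℝ (fderiv ℝ f) y :=
    (hf.fderiv_right (m := 1) (by norm_cast)).differentiableAt (by simp)
  rw [fderiv_clm_apply h hv]
  simp [add_comm]

theorem SFun.fderiv_inChart_lieDeriv (v : VField I M) (f : SFun I M) (x : M) (w : E) :
    fderiv ℝ ((f.lieDeriv v).inChart x) (extChartAt I x x) w =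
      fderiv ℝ (fderiv ℝ (f.inChart x)) (extChartAt I x x) w (v.inChart x (extChartAt I x x)) +
      fderiv ℝ (f.inChart x) (extChartAt I x x)
        (fderiv ℝ (v.inChart x) (extChartAt I x x) w) := by
  rw [← fderiv_fderiv_apply (f.contDiffAt_inChart (mem_extChartAt_target x))
    ((v.contDiffAt_inChart x).differentiableAt (by simp))]
  refine DFunLike.congr_fun (Filter.EventuallyEq.fderiv_eq ?_) w
  filter_upwards [(isOpen_extChartAt_target x).mem_nhds (mem_extChartAt_target x)] with y hy
  exact SFun.inChart_lieDeriv v f hy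

theorem SFun.differential_self (F : SFun I M) (x : M) (Y : E) :
    F.differential x Y =
      fderiv ℝ (F.inChart x) (extChartAt I x x) Y := by
  rw [F.differential_eq (mem_extChartAt_source x), chartDeriv_self]
  rfl

/-- The bracket on `M` is the bracket of the fields pulled back along the inverse chart. Near the
centre these pullbacks are the local expressions, and the derivative of the chart at its own centre
is the identity, so no correction factor remains. -/
theorem VField.bracket_apply [CompleteSpace E] (v w : VField I M) (x : M) :
    (v.bracket w).vec x = fderiv ℝ (w.inChart x) (extChartAt I x x) (v.inChart x (extChartAt I x x)) -
      fderiv ℝ (v.inChart x) (extChartAt I x x) (w.inChart x (extChartAt I x x)) := by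
  obtain ⟨P, hP⟩ : ∃ P : VField I M → E → E, ∀ u, P u = VectorField.mpullbackWithin 𝓘(ℝ, E) I
      (extChartAt I x).symm u (Set.range I) := ⟨_, fun _ => rfl⟩
  have e (u : VField I M) : P u =ᶠ[𝓝 (extChartAt I x x)] u.inChart x := by
    filter_upwards [(isOpen_extChartAt_target x).mem_nhds (mem_extChartAt_target x)] with y hy
    have h : (mfderivWithin 𝓘(ℝ, E) I (extChartAt I x).symm (Set.range I) y).inverse =
        mfderiv I 𝓘(ℝ, E) (extChartAt I x) ((extChartAt I x).symm y) :=
      ContinuousLinearMap.inverse_eq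
        (mfderivWithin_extChartAt_symm_comp_mfderiv_extChartAt hy)
        (mfderiv_extChartAt_comp_mfderivWithin_extChartAt_symm hy)
    rw [hP, VectorField.mpullbackWithin_apply, h]
    rfl
  have h : (v.bracket w).vec x = (chartDeriv I x x).inverse (VectorField.lieBracketWithin ℝ
      (P v) (P w) ((extChartAt I x).symm ⁻¹' Set.univ ∩ Set.range I) (extChartAt I x x)) := by
    rw [hP, hP]
    exact VectorField.mlieBracketWithin_apply
  rw [h, chartDeriv_self, ContinuousLinearMap.inverse_id, Set.preimage_univ, Set.univ_inter,
    I.range_eq_univ, VectorField.lieBracketWithin_univ]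
  exact (e v).lieBracket_vectorField_eq (e w)

/-- In the chart at `x` the second-order terms cancel by symmetry of the second derivative. -/
theorem SFun.lieDeriv_bracket [CompleteSpace E] (v w : VField I M) (f : SFun I M) :
    f.lieDeriv (v.bracket w) = (f.lieDeriv w).lieDeriv v - (f.lieDeriv v).lieDeriv w := by
  ext x
  have hs : IsSymmSndFDerivAt ℝ (f.inChart x) (extChartAt I x x) :=
    (f.contDiffAt_inChart (mem_extChartAt_target x)).isSymmSndFDerivAt
      (by rw [minSmoothness_of_isRCLikeNormedField]; norm_cast)
  change f.lieDeriv (v.bracket w) x = (f.lieDeriv w).lieDeriv v x - (f.lieDeriv v).lieDeriv w x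
  rw [SFun.lieDeriv_apply, SFun.lieDeriv_apply, SFun.lieDeriv_apply, SFun.differential_self,
    SFun.differential_self, SFun.differential_self, SFun.fderiv_inChart_lieDeriv,
    SFun.fderiv_inChart_lieDeriv, v.bracket_apply, map_sub, v.inChart_self, w.inChart_self,
    hs (v.vec x) (w.vec x)]
  ring

theorem DForm.inChart_eq (η : DForm I M 2) {x₀ x : M} (hx : x ∈ (extChartAt I x₀).source)
    (a b : E) :
    η.form x ![a, b] =
      η.inChart x₀ (extChartAt I x₀ x) ![chartDeriv I x₀ x a, chartDeriv I x₀ x b] :=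
  η.eq_inChart x₀ x hx a b

/-- The Hamiltonian equation at a point, in a chart. -/
theorem hamiltonian_eq_iff_inChart (Ω : DForm I M 2) (F : SFun I M) {x₀ x : M}
    (hx : x ∈ (extChartAt I x₀).source) (a : E) :
    (∀ Y : TangentSpace I x, Ω x ![a, Y] = mfderiv I 𝓘(ℝ, ℝ) F x Y) ↔
      ∀ z : E, Ω.inChart x₀ (extChartAt I x₀ x) ![chartDeriv I x₀ x a, z] =
        fderiv ℝ (F.inChart x₀) (extChartAt I x₀ x) z := by
  have h1 (Y : E) := Ω.inChart_eq hx a Y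
  have h2 (Y : E) := F.differential_eq hx Y
  constructor
  · intro h z
    -- The derivative of the chart is onto, so every test vector `z` comes from a tangent vector at
    -- `x`.
    have h3 := h (chartSymmDeriv I x₀ (extChartAt I x₀ x) z)
    have h4 := (h1 _).symm.trans (h3.trans (h2 _))
    rwa [chartDeriv_chartSymmDeriv hx] at h4
  · intro h Y
    exact (h1 Y).trans ((h _).trans (h2 Y).symm)

theorem IsHamiltonian.inChart {Ω : DForm I M 2} {X : VField I M} {F : SFun I M}
    (h : IsHamiltonian Ω X F) (x₀ : M) {y : E} (hy : y ∈ (extChartAt I x₀).target) (z : E) :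
    Ω.inChart x₀ y ![X.inChart x₀ y, z] = fderiv ℝ (F.inChart x₀) y z := by
  have h1 := (hamiltonian_eq_iff_inChart Ω F ((extChartAt I x₀).map_target hy) _).1 (h _) z
  rwa [(extChartAt I x₀).right_inv hy] at h1

omit [I.Boundaryless] in
/-- A field of tangent vectors is a smooth vector field if its local expressions are smooth. -/
theorem contMDiff_section_of_inChart (X : ∀ x : M, TangentSpace I x) (u : M → E → E)
    (hu : ∀ x₀, ContDiffAt ℝ ∞ (u x₀) (extChartAt I x₀ x₀))
    (h : ∀ x₀, ∀ᶠ x in 𝓝 x₀, chartDeriv I x₀ x (X x) = u x₀ (extChartAt I x₀ x)) :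
    ContMDiff I (I.prod 𝓘(ℝ, E)) ∞ (fun x => TotalSpace.mk' E x (X x)) := by
  intro x₀
  rw [contMDiffAt_section]
  refine ((hu x₀).contMDiffAt.comp x₀ contMDiffAt_extChartAt).congr_of_eventuallyEq ?_
  filter_upwards [(chartAt H x₀).open_source.mem_nhds (mem_chart_source H x₀), h x₀] with x hx h
  rw [Function.comp_apply, ← h, chartDeriv, TangentBundle.trivializationAt_apply,
    (hasMFDerivAt_extChartAt hx).mfderiv, mfderiv_chartAt_eq_tangentCoordChange hx]
  rfl

end Charts

end TwistedCotangent

namespace TwistedCotangent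

/-! ### Exterior calculus of 1- and 2-forms on a normed space. -/

section AlternatingForms

variable {E : Type*} [NormedAddCommGroup E] [NormedSpace ℝ E]

/-- Currying of alternating 2-forms. -/
def twoFormCurry : (E [⋀^Fin 2]→L[ℝ] ℝ) →L[ℝ] E →L[ℝ] E →L[ℝ] ℝ :=
  (ContinuousLinearMap.compL ℝ E _ _
    (continuousMultilinearCurryFin1 ℝ E ℝ).toContinuousLinearEquiv.toContinuousLinearMap) ∘L
  (continuousMultilinearCurryLeftEquiv ℝ
    (fun _ : Fin 2 => E) ℝ).toContinuousLinearEquiv.toContinuousLinearMap ∘L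
  ContinuousAlternatingMap.toContinuousMultilinearMapCLM ℝ (𝕜 := ℝ) (E := E) (F := ℝ) (ι := Fin 2)

theorem twoFormCurry_apply (σ : E [⋀^Fin 2]→L[ℝ] ℝ) (a b : E) :
    twoFormCurry σ a b = σ ![a, b] := by
  change σ _ = σ _
  congr 1
  funext i
  fin_cases i <;> rfl

theorem twoForm_swap (σ : E [⋀^Fin 2]→L[ℝ] ℝ) (a b : E) : σ ![a, b] = -σ ![b, a] := by
  have h := σ.toAlternatingMap.map_swap ![b, a] (show (0 : Fin 2) ≠ 1 by decide)
  have e : ![b, a] ∘ Equiv.swap (0 : Fin 2) 1 = ![a, b] := by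
    funext i
    fin_cases i <;> rfl
  rwa [e] at h

theorem twoForm_self (σ : E [⋀^Fin 2]→L[ℝ] ℝ) (a : E) : σ ![a, a] = 0 := by
  have := twoForm_swap σ a a
  linarith

theorem extDeriv_oneForm_apply {σ : E → E [⋀^Fin 1]→L[ℝ] ℝ} {x : E}
    (h : DifferentiableAt ℝ σ x) (a b : E) :
    extDeriv σ x ![a, b] = fderiv ℝ (fun y => σ y ![b]) x a - fderiv ℝ (fun y => σ y ![a]) x b := by
  have e1 : Fin.removeNth 0 ![a, b] = ![b] := by ext i; fin_cases i; rfl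
  have e2 : Fin.removeNth 1 ![a, b] = ![a] := by ext i; fin_cases i; rfl
  rw [extDeriv_apply h, Fin.sum_univ_two, e1, e2]
  simp [sub_eq_add_neg]

theorem fderiv_twoForm_apply {σ : E → E [⋀^Fin 2]→L[ℝ] ℝ} {u : E → E} {x : E}
    (hσ : DifferentiableAt ℝ σ x) (hu : DifferentiableAt ℝ u x) (b w : E) :
    fderiv ℝ (fun y => σ y ![u y, b]) x w =
      fderiv ℝ σ x w ![u x, b] + σ x ![fderiv ℝ u x w, b] := by
  -- With the second slot frozen at `b`, the form becomes an operator-valued map applied to `u`, to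
  -- which the product rule applies.
  let K : (E [⋀^Fin 2]→L[ℝ] ℝ) →L[ℝ] E →L[ℝ] ℝ :=
    ContinuousLinearMap.compL ℝ E (E →L[ℝ] ℝ) ℝ (ContinuousLinearMap.apply ℝ ℝ b) ∘L twoFormCurry
  have hK (τ : E [⋀^Fin 2]→L[ℝ] ℝ) (a : E) : K τ a = τ ![a, b] := twoFormCurry_apply τ a b
  have h1 : HasFDerivAt (fun y => K (σ y)) (K ∘L fderiv ℝ σ x) x :=
    K.hasFDerivAt.comp x hσ.hasFDerivAt
  have h2 := h1.clm_apply hu.hasFDerivAt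
  simp only [hK] at h2
  rw [h2.fderiv]
  simp [hK, add_comm]

theorem extDeriv_twoForm_apply {σ : E → E [⋀^Fin 2]→L[ℝ] ℝ} {x : E} (a b c : E) :
    extDeriv σ x ![a, b, c] =
      fderiv ℝ σ x a ![b, c] - fderiv ℝ σ x b ![a, c] + fderiv ℝ σ x c ![a, b] := by
  have e1 : Fin.removeNth 0 ![a, b, c] = ![b, c] := by ext i; fin_cases i <;> rfl
  have e2 : Fin.removeNth 1 ![a, b, c] = ![a, c] := by ext i; fin_cases i <;> rfl
  have e3 : Fin.removeNth 2 ![a, b, c] = ![a, b] := by ext i; fin_cases i <;> rfl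
  rw [extDeriv, ContinuousAlternatingMap.alternatizeUncurryFin_apply, Fin.sum_univ_three, e1, e2,
    e3]
  simp [sub_eq_add_neg]

/-- If `X` and `Y` are Hamiltonian vector fields of `F` and `G` for a closed 2-form, then `[X, Y]`
is a Hamiltonian vector field of `dG(X)`. -/
theorem twoForm_lieBracket {Ω : E → E [⋀^Fin 2]→L[ℝ] ℝ} {X Y : E → E} {F G : E → ℝ} {x : E}
    (hΩ : DifferentiableAt ℝ Ω x) (hX : DifferentiableAt ℝ X x) (hY : DifferentiableAt ℝ Y x)
    (hF : ContDiffAt ℝ ∞ F x) (hG : ContDiffAt ℝ ∞ G x) (hdΩ : extDeriv Ω x = 0)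
    (hXF : ∀ z, (fun y => Ω y ![X y, z]) =ᶠ[𝓝 x] fun y => fderiv ℝ F y z)
    (hYG : ∀ z, (fun y => Ω y ![Y y, z]) =ᶠ[𝓝 x] fun y => fderiv ℝ G y z) (z : E) :
    Ω x ![fderiv ℝ Y x (X x) - fderiv ℝ X x (Y x), z] =
      fderiv ℝ (fderiv ℝ G) x z (X x) + fderiv ℝ G x (fderiv ℝ X x z) := by
  have second {f : E → ℝ} (hf : ContDiffAt ℝ ∞ f x) (w z : E) :
      fderiv ℝ (fun y => fderiv ℝ f y z) x w = fderiv ℝ (fderiv ℝ f) x w z := by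
    simpa using fderiv_fderiv_apply hf (differentiableAt_const z) w
  have symm {f : E → ℝ} (hf : ContDiffAt ℝ ∞ f x) : IsSymmSndFDerivAt ℝ f x :=
    hf.isSymmSndFDerivAt (by rw [minSmoothness_of_isRCLikeNormedField]; norm_cast)
  -- The Hamiltonian equation `Ω(U, z) = df(z)`, differentiated in the direction `w`.
  have key {U : E → E} {f : E → ℝ} (hf : ContDiffAt ℝ ∞ f x) (hU : DifferentiableAt ℝ U x)
      (h : ∀ z, (fun y => Ω y ![U y, z]) =ᶠ[𝓝 x] fun y => fderiv ℝ f y z) (w z : E) :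
      fderiv ℝ Ω x w ![U x, z] + Ω x ![fderiv ℝ U x w, z] = fderiv ℝ (fderiv ℝ f) x w z := by
    rw [← second hf, ← (h z).fderiv_eq, fderiv_twoForm_apply hΩ hU]
  -- In `e1 - e2 + e3` the derivatives of `Ω` add up to `dΩ(X, Y, z) = 0`, and the two second
  -- derivatives of `F` cancel. The remaining term `Ω(DX z, Y)` is `-dG(DX z)`.
  have e1 := key hG hY hYG (X x) z
  have e2 := key hF hX hXF (Y x) z
  have e3 := key hF hX hXF z (Y x)
  have e4 := (hYG (fderiv ℝ X x z)).self_of_nhds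
  simp only at e4
  have e5 := twoForm_swap (Ω x) (Y x) (fderiv ℝ X x z)
  have e6 := symm hF z (Y x)
  have e7 := symm hG z (X x)
  have e8 : extDeriv Ω x ![X x, Y x, z] = 0 := by rw [hdΩ]; rfl
  rw [extDeriv_twoForm_apply] at e8
  rw [← twoFormCurry_apply, map_sub, sub_apply, twoFormCurry_apply,
    twoFormCurry_apply]
  linarith

theorem contDiff_linearOneForm (T : E →L[ℝ] E →L[ℝ] ℝ) :
    ContDiff ℝ ∞ (fun y => ContinuousAlternatingMap.ofSubsingletonLIE (𝕜 := ℝ) (0 : Fin 1) (T y)) :=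
  (ContinuousAlternatingMap.ofSubsingletonLIE (𝕜 := ℝ) (E := E) (F := ℝ) (0 : Fin 1)).contDiff.comp
    T.contDiff

theorem extDeriv_linearOneForm_apply (T : E →L[ℝ] E →L[ℝ] ℝ) (y a b : E) :
    extDeriv (fun y => ContinuousAlternatingMap.ofSubsingletonLIE (𝕜 := ℝ) (0 : Fin 1) (T y)) y
      ![a, b] = T a b - T b a := by
  rw [extDeriv_oneForm_apply ((contDiff_linearOneForm T).contDiffAt.differentiableAt (by simp))]
  have h (c w : E) : fderiv ℝ (fun y => T y c) y w = T w c := by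
    have : HasFDerivAt (fun y => T y c) (ContinuousLinearMap.apply ℝ ℝ c ∘L T) y :=
      (ContinuousLinearMap.apply ℝ ℝ c ∘L T).hasFDerivAt
    rw [this.fderiv]
    rfl
  exact congrArg₂ (· - ·) (h b a) (h a b)

variable {F : Type*} [NormedAddCommGroup F] [NormedSpace ℝ F]

/-- The sum of a constant form and the pullback of a closed form under a projection is closed. -/
theorem isClosed_const_add_pullback_fst {k : ℕ} (σ : (E × F) [⋀^Fin k]→L[ℝ] ℝ)
    {β : E → E [⋀^Fin k]→L[ℝ] ℝ} {y : E × F} (hβ : DifferentiableAt ℝ β y.1)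
    (hdβ : extDeriv β y.1 = 0) :
    DifferentiableAt ℝ (fun y => σ + (β y.1).compContinuousLinearMap
      (ContinuousLinearMap.fst ℝ E F)) y ∧
    extDeriv (fun y => σ + (β y.1).compContinuousLinearMap (ContinuousLinearMap.fst ℝ E F)) y
      = 0 := by
  have hD : DifferentiableAt ℝ (fun y : E × F =>
      (β y.1).compContinuousLinearMap (ContinuousLinearMap.fst ℝ E F)) y :=
    (DifferentiableAt.comp y hβ
      differentiableAt_fst).continuousAlternatingMapCompContinuousLinearMap
      (differentiableAt_const _)
  refine ⟨(differentiableAt_const σ).add hD, ?_⟩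
  have h := extDeriv_pullback (r := ∞) (x := y) (f := Prod.fst) hβ contDiffAt_fst
    (by rw [minSmoothness_of_isRCLikeNormedField]; norm_cast)
  simp only [fderiv_fst] at h
  have h2 : extDeriv (fun _ : E × F => σ) y = 0 := by
    ext v
    rw [extDeriv_apply (differentiableAt_const σ)]
    simp
  rw [extDeriv_fun_add (differentiableAt_const σ) hD, h, hdβ, h2, zero_add]
  ext v
  rfl

end AlternatingForms

/-! ### The Poisson algebra of a closed 2-form. -/

section Poisson

variable {E : Type*} [NormedAddCommGroup E] [NormedSpace ℝ E]
  {H : Type*} [TopologicalSpace H] {I : ModelWithCorners ℝ E H}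
  {M : Type*} [TopologicalSpace M] [ChartedSpace H M] [IsManifold I ∞ M]

theorem isHamiltonian_iff {Ω : DForm I M 2} {X : VField I M} {F : SFun I M} :
    IsHamiltonian Ω X F ↔ ∀ (x : M) (Y : E),
      Ω.form x ![X.vec x, Y] = F.differential x Y :=
  Iff.rfl

theorem IsHamiltonian.lieDeriv_apply {Ω : DForm I M 2} {X Y : VField I M} {G : SFun I M}
    (hY : IsHamiltonian Ω Y G) (x : M) :
    G.lieDeriv X x = Ω.form x ![Y.vec x, X.vec x] :=
  (hY x (X x)).symm

theorem IsHamiltonian.lieDeriv_eq_neg {Ω : DForm I M 2} {X Y : VField I M} {F G : SFun I M}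
    (hX : IsHamiltonian Ω X F) (hY : IsHamiltonian Ω Y G) : G.lieDeriv X = -F.lieDeriv Y := by
  ext x
  change G.lieDeriv X x = -F.lieDeriv Y x
  rw [hY.lieDeriv_apply, hX.lieDeriv_apply, twoForm_swap]

theorem IsHamiltonian.lieDeriv_self {Ω : DForm I M 2} {X : VField I M} {F : SFun I M}
    (hX : IsHamiltonian Ω X F) : F.lieDeriv X = 0 := by
  ext x
  rw [hX.lieDeriv_apply, twoForm_self]
  rfl

theorem SFun.lieDeriv_add (X : VField I M) (F G : SFun I M) :
    (F + G).lieDeriv X = F.lieDeriv X + G.lieDeriv X := by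
  ext x
  change (F + G).differential x (X.vec x) =
    F.differential x (X.vec x) + G.differential x (X.vec x)
  rw [← add_apply]
  congr 1
  exact mfderiv_add F.mdifferentiableAt G.mdifferentiableAt

theorem SFun.lieDeriv_smul (X : VField I M) (r : ℝ) (F : SFun I M) :
    (r • F).lieDeriv X = r • F.lieDeriv X := by
  ext x
  change (r • F).differential x (X.vec x) = (r • F.differential x) (X.vec x)
  congr 1
  exact const_smul_mfderiv F.mdifferentiableAt r

theorem isHamiltonian_hamiltonianField (Ω : DForm I M 2) (F : hamiltonianFunctions Ω) :
    IsHamiltonian Ω (hamiltonianField Ω F) F.1 :=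
  F.2.choose_spec

variable [CompleteSpace E] [I.Boundaryless]

/-- The 2-form `η` is differentiable and closed, as seen at each point in the chart centred
there. -/
structure DForm.IsClosedAtCentres (η : DForm I M 2) : Prop where
  differentiableAt : ∀ x, DifferentiableAt ℝ (η.inChart x) (extChartAt I x x)
  extDeriv_eq_zero : ∀ x, extDeriv (η.inChart x) (extChartAt I x x) = 0

theorem IsHamiltonian.bracket {Ω : DForm I M 2} (hΩ : Ω.IsClosedAtCentres) {X Y : VField I M}
    {F G : SFun I M} (hX : IsHamiltonian Ω X F) (hY : IsHamiltonian Ω Y G) :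
    IsHamiltonian Ω (X.bracket Y) (G.lieDeriv X) := by
  rw [isHamiltonian_iff]
  intro x z
  have near {U : VField I M} {f : SFun I M} (h : IsHamiltonian Ω U f) (z : E) :
      (fun y => Ω.inChart x y ![U.inChart x y, z]) =ᶠ[𝓝 (extChartAt I x x)]
        fun y => fderiv ℝ (f.inChart x) y z := by
    filter_upwards [extChartAt_target_mem_nhds x] with y hy
    exact h.inChart x hy z
  have e := Ω.inChart_eq (mem_extChartAt_source (I := I) x) ((X.bracket Y).vec x) z
  rw [chartDeriv_self, ContinuousLinearMap.id_apply, ContinuousLinearMap.id_apply] at e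
  rw [e, VField.bracket_apply, SFun.differential_self, SFun.fderiv_inChart_lieDeriv]
  exact twoForm_lieBracket (hΩ.differentiableAt x)
    ((X.contDiffAt_inChart x).differentiableAt (by simp))
    ((Y.contDiffAt_inChart x).differentiableAt (by simp))
    (F.contDiffAt_inChart (mem_extChartAt_target x))
    (G.contDiffAt_inChart (mem_extChartAt_target x)) (hΩ.extDeriv_eq_zero x)
    (near hX) (near hY) z

/-- The Poisson bracket of a closed 2-form, with values in the functions that have a Hamiltonian
vector field. -/
def poissonBr (Ω : DForm I M 2) (hΩ : Ω.IsClosedAtCentres) (F G : hamiltonianFunctions Ω) :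
    hamiltonianFunctions Ω :=
  ⟨G.1.lieDeriv (hamiltonianField Ω F), _,
    (isHamiltonian_hamiltonianField Ω F).bracket hΩ (isHamiltonian_hamiltonianField Ω G)⟩

theorem coe_poissonBr (Ω : DForm I M 2) (hΩ : Ω.IsClosedAtCentres) (F G : hamiltonianFunctions Ω) :
    ⇑(poissonBr Ω hΩ F G).1 = poissonBracket Ω F G := by
  funext x
  exact (isHamiltonian_hamiltonianField Ω G).lieDeriv_apply x

/-- Antisymmetry turns the derivative along `X` into minus the derivative of `F` along a field of
`G`, where `X` no longer occurs. This permits replacing the chosen field by a convenient one, such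
as a bracket. -/
theorem poissonBr_eq {Ω : DForm I M 2} (hΩ : Ω.IsClosedAtCentres) {F : hamiltonianFunctions Ω}
    {X : VField I M} (hX : IsHamiltonian Ω X F.1) (G : hamiltonianFunctions Ω) :
    (poissonBr Ω hΩ F G).1 = G.1.lieDeriv X := by
  change G.1.lieDeriv (hamiltonianField Ω F) = _
  rw [(isHamiltonian_hamiltonianField Ω F).lieDeriv_eq_neg (isHamiltonian_hamiltonianField Ω G),
    hX.lieDeriv_eq_neg (isHamiltonian_hamiltonianField Ω G)]

theorem poissonBr_swap {Ω : DForm I M 2} (hΩ : Ω.IsClosedAtCentres) (F G : hamiltonianFunctions Ω) :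
    poissonBr Ω hΩ F G = -poissonBr Ω hΩ G F :=
  Subtype.ext ((isHamiltonian_hamiltonianField Ω F).lieDeriv_eq_neg
    (isHamiltonian_hamiltonianField Ω G))

theorem isLieBracket_poissonBr (Ω : DForm I M 2) (hΩ : Ω.IsClosedAtCentres) :
    IsLieBracket (poissonBr Ω hΩ) := by
  have add_right (F G K) : poissonBr Ω hΩ F (G + K) = poissonBr Ω hΩ F G + poissonBr Ω hΩ F K :=
    Subtype.ext (SFun.lieDeriv_add _ _ _)
  have smul_right (r : ℝ) (F G) : poissonBr Ω hΩ F (r • G) = r • poissonBr Ω hΩ F G :=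
    Subtype.ext (SFun.lieDeriv_smul _ _ _)
  have neg_right (F G) : poissonBr Ω hΩ F (-G) = -poissonBr Ω hΩ F G :=
    (AddMonoidHom.mk' (poissonBr Ω hΩ F) (add_right F)).map_neg G
  refine ⟨fun F G K => ?_, fun r F G => ?_, add_right, smul_right, fun F => ?_, fun F G K => ?_⟩
  · rw [poissonBr_swap, add_right, neg_add, ← poissonBr_swap, ← poissonBr_swap]
  · rw [poissonBr_swap, smul_right]
    exact (smul_neg r _).symm.trans (congrArg (r • ·) (poissonBr_swap hΩ F G).symm)
  · exact Subtype.ext (isHamiltonian_hamiltonianField Ω F).lieDeriv_self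
  -- The bracket of the two Hamiltonian fields serves as a Hamiltonian field of `{F, G}`, so the
  -- Leibniz form of the Jacobi identity is `SFun.lieDeriv_bracket`.
  · have h : (poissonBr Ω hΩ (poissonBr Ω hΩ F G) K).1 =
        (poissonBr Ω hΩ F (poissonBr Ω hΩ G K)).1 - (poissonBr Ω hΩ G (poissonBr Ω hΩ F K)).1 := by
      rw [poissonBr_eq hΩ ((isHamiltonian_hamiltonianField Ω F).bracket hΩ
        (isHamiltonian_hamiltonianField Ω G)), SFun.lieDeriv_bracket]
      rfl
    have h' : poissonBr Ω hΩ (poissonBr Ω hΩ F G) K =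
        poissonBr Ω hΩ F (poissonBr Ω hΩ G K) - poissonBr Ω hΩ G (poissonBr Ω hΩ F K) :=
      Subtype.ext h
    have n : poissonBr Ω hΩ G (poissonBr Ω hΩ K F) = -poissonBr Ω hΩ G (poissonBr Ω hΩ F K) := by
      rw [poissonBr_swap hΩ K F, neg_right]
    rw [n, poissonBr_swap hΩ K, h']
    abel

end Poisson

end TwistedCotangent

namespace TwistedCotangent

/-! ### Naturality of pullback and of the exterior derivative. -/

section Pullback

variable {E : Type*} [NormedAddCommGroup E] [NormedSpace ℝ E]
  {H : Type*} [TopologicalSpace H] {I : ModelWithCorners ℝ E H}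
  {M : Type*} [TopologicalSpace M] [ChartedSpace H M]
  {E' : Type*} [NormedAddCommGroup E'] [NormedSpace ℝ E']
  {H' : Type*} [TopologicalSpace H'] {I' : ModelWithCorners ℝ E' H'}
  {M' : Type*} [TopologicalSpace M'] [ChartedSpace H' M']
  {E'' : Type*} [NormedAddCommGroup E''] [NormedSpace ℝ E'']
  {H'' : Type*} [TopologicalSpace H''] {I'' : ModelWithCorners ℝ E'' H''}
  {M'' : Type*} [TopologicalSpace M''] [ChartedSpace H'' M'']

theorem DForm.pullback_congr {k : ℕ} (η : DForm I M k) {f g : M' → M} {y : M'}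
    (h : f =ᶠ[𝓝 y] g) : η.pullback (I' := I') f y = η.pullback (I' := I') g y := by
  -- The tangent spaces at `f y` and `g y` are formally different types; a free base point `z` and a
  -- derivative `L` between model spaces make the substitution possible.
  have key : ∀ (z : M) (_ : z = g y) (L : E' →L[ℝ] E), L = (mfderiv I' I g y : E' →L[ℝ] E) →
      (η.form z).compContinuousLinearMap L =
        (η.form (g y)).compContinuousLinearMap (mfderiv I' I g y : E' →L[ℝ] E) := by
    rintro z rfl L rfl
    rfl
  exact key (f y) h.self_of_nhds (mfderiv I' I f y) h.mfderiv_eq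

theorem DForm.pullback_pullback {k : ℕ} (η : DForm I M k) {f : M' → M} {g : M'' → M'} {y : M''}
    (hf : MDifferentiableAt I' I f (g y)) (hg : MDifferentiableAt I'' I' g y) :
    (η.pullback (I' := I') f).pullback (I' := I'') g y = η.pullback (I' := I'') (f ∘ g) y := by
  change _ = (η ((f ∘ g) y)).compContinuousLinearMap (mfderiv I'' I (f ∘ g) y)
  rw [mfderiv_comp y hf hg]
  rfl

variable [IsManifold I ∞ M] [I.Boundaryless]

/-- The exterior derivative commutes with the passage to any chart. -/
theorem DForm.inChart_d {k : ℕ} (η : DForm I M k)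
    (hη : ∀ x, DifferentiableAt ℝ (η.inChart x) (extChartAt I x x)) {x₀ : M} {y : E}
    (hy : y ∈ (extChartAt I x₀).target) : η.d.inChart x₀ y = extDeriv (η.inChart x₀) y := by
  obtain ⟨x, hx⟩ : ∃ x, x = (extChartAt I x₀).symm y := ⟨_, rfl⟩
  -- `d` at `x` is defined in the chart at `x`, so the transition map `τ` from the chart at `x₀` to
  -- that one is needed. It carries `y` to the centre, the only point where `hη` gives
  -- differentiability.
  obtain ⟨τ, hτ⟩ : ∃ τ : E → E, τ = extChartAt I x ∘ (extChartAt I x₀).symm := ⟨_, rfl⟩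
  have hτy : τ y = extChartAt I x x := by rw [hτ, Function.comp_apply, hx]
  have hsmooth : ContDiffAt ℝ ∞ τ y := by
    rw [hτ]
    exact contDiffAt_comp_extChartAt_symm hy (by rw [← hx]; exact contMDiffAt_extChartAt)
  have hcont : ContinuousAt (extChartAt I x₀).symm y :=
    (mdifferentiableAt_extChartAt_symm hy).continuousAt
  have hmem : ∀ᶠ y' in 𝓝 y, (extChartAt I x₀).symm y' ∈ (extChartAt I x).source :=
    hcont.preimage_mem_nhds (by rw [← hx]; exact extChartAt_source_mem_nhds x)
  have e : η.inChart x₀ =ᶠ[𝓝 y] fun y' =>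
      (η.inChart x (τ y')).compContinuousLinearMap (fderiv ℝ τ y') := by
    filter_upwards [hmem.eventually_nhds, (isOpen_extChartAt_target x₀).mem_nhds hy,
      (hsmooth.of_le (m := 1) (by norm_cast)).eventually (by simp)] with y' hy' hy₀ hd
    have h1 : (extChartAt I x₀).symm =ᶠ[𝓝 y'] (extChartAt I x).symm ∘ τ := by
      filter_upwards [hy'] with z hz
      rw [hτ, Function.comp_apply, Function.comp_apply, (extChartAt I x).left_inv hz]
    have h2 : τ y' ∈ (extChartAt I x).target := by
      rw [hτ]
      exact (extChartAt I x).map_source hy'.self_of_nhds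
    have h3 : MDifferentiableAt 𝓘(ℝ, E) 𝓘(ℝ, E) τ y' :=
      (hd.differentiableAt (by simp)).mdifferentiableAt
    have h4 := η.pullback_pullback (mdifferentiableAt_extChartAt_symm h2) h3
    change η.pullback (I' := 𝓘(ℝ, E)) (extChartAt I x₀).symm y' = _
    rw [η.pullback_congr h1, ← h4, ← mfderiv_eq_fderiv]
    rfl
  have hτd : chartDeriv I x ((extChartAt I x₀).symm y) ∘L
      chartSymmDeriv I x₀ y = fderiv ℝ τ y := by
    have hc : MDifferentiableAt I 𝓘(ℝ, E) (extChartAt I x) ((extChartAt I x₀).symm y) := by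
      rw [← hx]
      exact mdifferentiableAt_extChartAt (mem_chart_source H x)
    rw [← mfderiv_eq_fderiv, hτ]
    exact (mfderiv_comp y hc (mdifferentiableAt_extChartAt_symm hy)).symm
  rw [e.extDeriv_eq, extDeriv_pullback (by rw [hτy]; exact hη x) hsmooth
    (by rw [minSmoothness_of_isRCLikeNormedField]; norm_cast), ← hτd, hτy]
  subst hx
  rfl

end Pullback

/-! ### The charts of the cotangent bundle and the canonical form in them. -/

section CotangentChart

variable {E : Type*} [NormedAddCommGroup E] [NormedSpace ℝ E]
  {H : Type*} [TopologicalSpace H] {I : ModelWithCorners ℝ E H}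
  {M : Type*} [TopologicalSpace M] [ChartedSpace H M] [IsManifold I ∞ M]

/-- The covector of a point of the cotangent bundle, as a linear form on the model space. -/
def Cotangent.covector (β : Cotangent I M) : E →L[ℝ] ℝ := β.snd

theorem cotangent_mem_source {α β : Cotangent I M} :
    β ∈ (extChartAt (cotangentModel I) α).source ↔ β.proj ∈ (extChartAt I α.proj).source := by
  rw [FiberBundle.extChartAt]
  simp only [PartialEquiv.trans_source, PartialEquiv.prod_source, PartialEquiv.refl_source,
    Set.mem_inter_iff, Set.mem_preimage, Set.mem_prod, Set.mem_univ, and_true]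
  constructor
  · exact fun h => h.2
  · refine fun h => ⟨?_, h⟩
    rw [extChartAt_source] at h
    refine (Bundle.Trivialization.mem_source _).2 ?_
    rw [hom_trivializationAt_baseSet]
    exact ⟨h, Set.mem_univ _⟩

theorem cotangent_chart_fst (α β : Cotangent I M) :
    (extChartAt (cotangentModel I) α β).1 = extChartAt I α.proj β.proj := by
  rw [FiberBundle.extChartAt]
  rfl

/-- The fibre coordinate of a covector is its composite with the inverse of the tangent
trivialisation, and that trivialisation is the derivative of the base chart. -/
theorem cotangent_chart_snd {α β : Cotangent I M} (h : β.proj ∈ (extChartAt I α.proj).source)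
    (c : E) : (extChartAt (cotangentModel I) α β).2 (chartDeriv I α.proj β.proj c) =
      Cotangent.covector β c := by
  rw [extChartAt_source] at h
  have e : chartDeriv I α.proj β.proj = ((trivializationAt E (TangentSpace I : M → Type _)
      α.proj).continuousLinearMapAt ℝ β.proj : E →L[ℝ] E) :=
    (TangentBundle.continuousLinearMapAt_trivializationAt h).symm
  have hb : β.proj ∈ (trivializationAt E (TangentSpace I : M → Type _) α.proj).baseSet := h
  have e2 : (trivializationAt E (TangentSpace I : M → Type _) α.proj).symmL ℝ β.proj
      ((trivializationAt E (TangentSpace I : M → Type _) α.proj).continuousLinearMapAt ℝ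
        β.proj c) = c :=
    Bundle.Trivialization.symmL_continuousLinearMapAt _ hb c
  rw [FiberBundle.extChartAt]
  change (trivializationAt (E →L[ℝ] ℝ) _ α.proj β).2 _ = _
  rw [hom_trivializationAt_apply, e]
  have e3 : ContinuousLinearMap.inCoordinates E (TangentSpace I : M → Type _) ℝ
      (Bundle.Trivial M ℝ) α.proj β.proj α.proj β.proj β.snd =
      Cotangent.covector β ∘L ((trivializationAt E (TangentSpace I : M → Type _)
        α.proj).symmL ℝ β.proj : E →L[ℝ] E) := by
    have e4 : (trivializationAt ℝ (Bundle.Trivial M ℝ) α.proj).continuousLinearMapAt ℝ β.proj =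
        ContinuousLinearMap.id ℝ ℝ :=
      Bundle.Trivial.continuousLinearMapAt_trivialization ℝ M ℝ β.proj
    rw [ContinuousLinearMap.inCoordinates, e4]
    rfl
  rw [e3]
  exact congrArg (Cotangent.covector β) e2

theorem cotangent_mem_target {α : Cotangent I M} {y : E × (E →L[ℝ] ℝ)} :
    y ∈ (extChartAt (cotangentModel I) α).target ↔ y.1 ∈ (extChartAt I α.proj).target := by
  rw [FiberBundle.extChartAt_target]
  simp only [Set.mem_prod, Set.mem_inter_iff, Set.mem_preimage, Set.mem_univ, and_true,
    and_iff_left_iff_imp]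
  intro h
  have := (extChartAt I α.proj).map_target h
  rw [extChartAt_source] at this
  simpa using this

theorem cotangent_chart_symm_proj {α : Cotangent I M} {y : E × (E →L[ℝ] ℝ)}
    (hy : y ∈ (extChartAt (cotangentModel I) α).target) :
    ((extChartAt (cotangentModel I) α).symm y).proj = (extChartAt I α.proj).symm y.1 := by
  have h := cotangent_chart_fst α ((extChartAt (cotangentModel I) α).symm y)
  rw [(extChartAt (cotangentModel I) α).right_inv hy] at h
  rw [h, (extChartAt I α.proj).left_inv
    (cotangent_mem_source.1 ((extChartAt (cotangentModel I) α).map_target hy))]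

/-- The derivative of the projection, on the model spaces. -/
def projDeriv (β : Cotangent I M) : E × (E →L[ℝ] ℝ) →L[ℝ] E :=
  mfderiv (cotangentModel I) I (cotangentProj I M) β

theorem contMDiff_cotangentProj : ContMDiff (cotangentModel I) I ∞ (cotangentProj I M) :=
  contMDiff_proj _

/-- Chain rule for both sides of `chart ∘ p = fst ∘ chart`. -/
theorem chartDeriv_projDeriv {α β : Cotangent I M}
    (h : β.proj ∈ (extChartAt I α.proj).source) (Y : E × (E →L[ℝ] ℝ)) :
    chartDeriv I α.proj β.proj (projDeriv β Y) = (chartDeriv (cotangentModel I) α β Y).1 := by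
  have h' := cotangent_mem_source.2 h
  rw [extChartAt_source] at h h'
  have hc : MDifferentiableAt I 𝓘(ℝ, E) (extChartAt I α.proj) (cotangentProj I M β) :=
    mdifferentiableAt_extChartAt h
  have hc' := mdifferentiableAt_extChartAt (I := cotangentModel I) h'
  have hp : MDifferentiableAt (cotangentModel I) I (cotangentProj I M) β :=
    contMDiff_cotangentProj.mdifferentiableAt (by simp)
  have e : extChartAt I α.proj ∘ cotangentProj I M =
      (ContinuousLinearMap.fst ℝ E (E →L[ℝ] ℝ)) ∘ extChartAt (cotangentModel I) α :=
    funext fun β => (cotangent_chart_fst α β).symm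
  have e1 := mfderiv_comp β hc hp
  have e2 := mfderiv_comp β
    (ContinuousLinearMap.fst ℝ E (E →L[ℝ] ℝ)).differentiableAt.mdifferentiableAt hc'
  rw [mfderiv_eq_fderiv, ContinuousLinearMap.fderiv] at e2
  rw [e] at e1
  exact DFunLike.congr_fun (e1.symm.trans e2) Y

theorem liouville_form_apply (β : Cotangent I M) (v : Fin 1 → E × (E →L[ℝ] ℝ)) :
    (liouville I M).form β v = Cotangent.covector β (projDeriv β (v 0)) := rfl

variable [I.Boundaryless]

omit [IsManifold I ∞ M] [I.Boundaryless] in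
theorem DForm.inChart_apply {k : ℕ} (η : DForm I M k) (x₀ : M) (y : E) (v : Fin k → E) :
    η.inChart x₀ y v =
      η.form ((extChartAt I x₀).symm y) (fun i => chartSymmDeriv I x₀ y (v i)) := rfl

/-- The tautological 1-form of `E × E*`, as a bilinear form. -/
def tautologicalForm (E : Type*) [NormedAddCommGroup E] [NormedSpace ℝ E] :
    E × (E →L[ℝ] ℝ) →L[ℝ] E × (E →L[ℝ] ℝ) →L[ℝ] ℝ :=
  (ContinuousLinearMap.compL ℝ (E × (E →L[ℝ] ℝ)) E ℝ).flip
    (ContinuousLinearMap.fst ℝ E (E →L[ℝ] ℝ)) ∘L ContinuousLinearMap.snd ℝ E (E →L[ℝ] ℝ)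

theorem tautologicalForm_apply (a b : E × (E →L[ℝ] ℝ)) :
    tautologicalForm E a b = a.2 b.1 := rfl

/-- The chart of `T^*M` is the cotangent lift of the base chart, and the Liouville form is invariant
under such lifts. -/
theorem liouville_inChart {α : Cotangent I M} {y : E × (E →L[ℝ] ℝ)}
    (hy : y ∈ (extChartAt (cotangentModel I) α).target) :
    (liouville I M).inChart α y = ContinuousAlternatingMap.ofSubsingletonLIE (𝕜 := ℝ) (0 : Fin 1)
      (tautologicalForm E y) := by
  have hs := (extChartAt (cotangentModel I) α).map_target hy
  have hr := (extChartAt (cotangentModel I) α).right_inv hy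
  ext v
  change _ = y.2 (v 0).1
  have h := chartDeriv_chartSymmDeriv hs (v 0)
  rw [hr] at h
  rw [DForm.inChart_apply, liouville_form_apply,
    ← cotangent_chart_snd (cotangent_mem_source.1 hs),
    chartDeriv_projDeriv (cotangent_mem_source.1 hs), hr, h]

/-- The canonical symplectic form of `E × E*`. -/
def modelForm (E : Type*) [NormedAddCommGroup E] [NormedSpace ℝ E] :
    (E × (E →L[ℝ] ℝ)) [⋀^Fin 2]→L[ℝ] ℝ :=
  -extDeriv (fun y : E × (E →L[ℝ] ℝ) => ContinuousAlternatingMap.ofSubsingletonLIE (𝕜 := ℝ)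
    (0 : Fin 1) (tautologicalForm E y)) 0

theorem modelForm_apply (a b : E × (E →L[ℝ] ℝ)) :
    modelForm E ![a, b] = b.2 a.1 - a.2 b.1 := by
  have h := extDeriv_linearOneForm_apply (tautologicalForm E) 0 a b
  change -(extDeriv _ 0 ![a, b]) = _
  rw [h, tautologicalForm_apply, tautologicalForm_apply]
  ring

/-- The tautological form depends linearly on the point, so its exterior derivative is constant;
this is why `modelForm` may be defined by the value at `0`. -/
theorem extDeriv_tautologicalForm (y : E × (E →L[ℝ] ℝ)) :
    extDeriv (fun y : E × (E →L[ℝ] ℝ) => ContinuousAlternatingMap.ofSubsingletonLIE (𝕜 := ℝ)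
      (0 : Fin 1) (tautologicalForm E y)) y = -modelForm E := by
  ext v
  have hv : v = ![v 0, v 1] := by
    funext i
    fin_cases i <;> rfl
  rw [hv, extDeriv_linearOneForm_apply, tautologicalForm_apply, tautologicalForm_apply]
  change _ = -(modelForm E _)
  rw [modelForm_apply]
  ring

theorem canonicalForm_inChart {α : Cotangent I M} {y : E × (E →L[ℝ] ℝ)}
    (hy : y ∈ (extChartAt (cotangentModel I) α).target) :
    (canonicalForm I M).inChart α y = modelForm E := by
  have e (α : Cotangent I M) {y : E × (E →L[ℝ] ℝ)}
      (hy : y ∈ (extChartAt (cotangentModel I) α).target) : (liouville I M).inChart α =ᶠ[𝓝 y]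
      fun y => ContinuousAlternatingMap.ofSubsingletonLIE (𝕜 := ℝ)
        (0 : Fin 1) (tautologicalForm E y) := by
    filter_upwards [(isOpen_extChartAt_target α).mem_nhds hy] with z hz
    exact liouville_inChart hz
  have hd (α : Cotangent I M) : DifferentiableAt ℝ ((liouville I M).inChart α)
      (extChartAt (cotangentModel I) α α) :=
    ((contDiff_linearOneForm (tautologicalForm E)).contDiffAt.differentiableAt
      (by simp)).congr_of_eventuallyEq (e α (mem_extChartAt_target α))
  have h := (liouville I M).inChart_d hd hy
  rw [(e α hy).extDeriv_eq, extDeriv_tautologicalForm] at h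
  change -((liouville I M).d.inChart α y) = _
  rw [h, neg_neg]

theorem pullback_proj_inChart (B : DForm I M 2) {α : Cotangent I M} {y : E × (E →L[ℝ] ℝ)}
    (hy : y ∈ (extChartAt (cotangentModel I) α).target) :
    (B.pullback (I' := cotangentModel I) (cotangentProj I M)).inChart α y =
      (B.inChart α.proj y.1).compContinuousLinearMap
        (ContinuousLinearMap.fst ℝ E (E →L[ℝ] ℝ)) := by
  have e : cotangentProj I M ∘ (extChartAt (cotangentModel I) α).symm =ᶠ[𝓝 y]
      (extChartAt I α.proj).symm ∘ ContinuousLinearMap.fst ℝ E (E →L[ℝ] ℝ) := by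
    filter_upwards [(isOpen_extChartAt_target α).mem_nhds hy] with z hz
    exact cotangent_chart_symm_proj hz
  have h := B.pullback_pullback (I'' := 𝓘(ℝ, E × (E →L[ℝ] ℝ)))
    (contMDiff_cotangentProj.mdifferentiableAt (by simp)) (mdifferentiableAt_extChartAt_symm hy)
  have h' := B.pullback_pullback (I'' := 𝓘(ℝ, E × (E →L[ℝ] ℝ)))
    (g := ContinuousLinearMap.fst ℝ E (E →L[ℝ] ℝ)) (y := y)
    (mdifferentiableAt_extChartAt_symm (cotangent_mem_target.1 hy))
    (ContinuousLinearMap.fst ℝ E (E →L[ℝ] ℝ)).differentiableAt.mdifferentiableAt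
  have h3 : fderiv ℝ (ContinuousLinearMap.fst ℝ E (E →L[ℝ] ℝ)) y =
    ContinuousLinearMap.fst ℝ E (E →L[ℝ] ℝ) := ContinuousLinearMap.fderiv _
  change DForm.pullback _ _ _ = _
  rw [h, B.pullback_congr e, ← h']
  change (B.inChart α.proj y.1).compContinuousLinearMap (mfderiv _ _ _ y) = _
  rw [mfderiv_eq_fderiv, h3]
  rfl

theorem twistedForm_inChart (B : DForm I M 2) {α : Cotangent I M} {y : E × (E →L[ℝ] ℝ)}
    (hy : y ∈ (extChartAt (cotangentModel I) α).target) :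
    (twistedForm B).inChart α y = modelForm E + (B.inChart α.proj y.1).compContinuousLinearMap
      (ContinuousLinearMap.fst ℝ E (E →L[ℝ] ℝ)) := by
  rw [← canonicalForm_inChart hy, ← pullback_proj_inChart B hy]
  rfl

theorem twistedForm_inChart_apply (B : DForm I M 2) {α : Cotangent I M} {y : E × (E →L[ℝ] ℝ)}
    (hy : y ∈ (extChartAt (cotangentModel I) α).target) (a b : E × (E →L[ℝ] ℝ)) :
    (twistedForm B).inChart α y ![a, b] =
      b.2 a.1 - a.2 b.1 + B.inChart α.proj y.1 ![a.1, b.1] := by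
  rw [twistedForm_inChart B hy]
  change modelForm E ![a, b] + B.inChart α.proj y.1 _ = _
  rw [modelForm_apply]
  congr 2
  funext i
  fin_cases i <;> rfl

theorem isClosedAtCentres_twistedForm {B : DForm I M 2} (hB : B.IsSmooth) (hdB : B.d = 0) :
    (twistedForm B).IsClosedAtCentres := by
  -- Vanishing of `B.d` at `x` is a statement about the chart at `x`. The chart at `α` lies over the
  -- chart at `α.proj`, centre over centre, so this is all that is needed.
  have hc (x : M) : extDeriv (B.inChart x) (extChartAt I x x) = 0 := by
    ext v
    have h : (extDeriv (B.inChart x) (extChartAt I x x)).compContinuousLinearMap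
        (chartDeriv I x x) = 0 := congrFun hdB x
    rw [chartDeriv_self] at h
    exact DFunLike.congr_fun h v
  have hd (x : M) : DifferentiableAt ℝ (B.inChart x) (extChartAt I x x) :=
    ((hB x).contDiffAt (extChartAt_target_mem_nhds x)).differentiableAt (by simp)
  have key (α : Cotangent I M) := isClosed_const_add_pullback_fst
    (y := extChartAt (cotangentModel I) α α) (modelForm E) (β := B.inChart α.proj)
    (by rw [cotangent_chart_fst]; exact hd _) (by rw [cotangent_chart_fst]; exact hc _)
  have e (α : Cotangent I M) : (twistedForm B).inChart α
      =ᶠ[𝓝 (extChartAt (cotangentModel I) α α)] fun y => modelForm E +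
        (B.inChart α.proj y.1).compContinuousLinearMap
          (ContinuousLinearMap.fst ℝ E (E →L[ℝ] ℝ)) := by
    filter_upwards [extChartAt_target_mem_nhds α] with y hy
    exact twistedForm_inChart B hy
  exact ⟨fun α => (key α).1.congr_of_eventuallyEq (e α),
    fun α => (e α).extDeriv_eq.trans (key α).2⟩

end CotangentChart

end TwistedCotangent

namespace TwistedCotangent

/-! ### Existence of Hamiltonian vector fields for the twisted form. -/

section HamiltonianFunctions

variable {E : Type*} [NormedAddCommGroup E] [NormedSpace ℝ E]
  {H : Type*} [TopologicalSpace H] {I : ModelWithCorners ℝ E H}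
  {M : Type*} [TopologicalSpace M] [ChartedSpace H M] [IsManifold I ∞ M] [I.Boundaryless]

/-- Vectors `(0, η)` detect the first component by Hahn-Banach. Once the first components agree, the
`B`-terms agree too, and vectors `(c, 0)` detect the second. -/
theorem twistedForm_inChart_nondegenerate (B : DForm I M 2) {α : Cotangent I M}
    {y : E × (E →L[ℝ] ℝ)} (hy : y ∈ (extChartAt (cotangentModel I) α).target)
    {a b : E × (E →L[ℝ] ℝ)}
    (h : ∀ z, (twistedForm B).inChart α y ![a, z] = (twistedForm B).inChart α y ![b, z]) :
    a = b := by
  simp only [twistedForm_inChart_apply B hy] at h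
  have h0 (c : E) : B.inChart α.proj y.1 ![c, 0] = 0 :=
    (B.inChart α.proj y.1).map_coord_zero 1 rfl
  have h1 : a.1 = b.1 := by
    refine (SeparatingDual.eq_iff_forall_dual_eq (R := ℝ)).2 fun η => ?_
    simpa [h0] using h (0, η)
  refine Prod.ext h1 (ContinuousLinearMap.ext fun c => ?_)
  simpa [h1] using h (c, 0)

/-- The expression in a chart of the Hamiltonian vector field of `F`, where `u` is the derivative of
`F` along the fibres. -/
def localHamiltonianField (β : E → E [⋀^Fin 2]→L[ℝ] ℝ) (F : E × (E →L[ℝ] ℝ) → ℝ)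
    (u : E × (E →L[ℝ] ℝ) → E) (y : E × (E →L[ℝ] ℝ)) : E × (E →L[ℝ] ℝ) :=
  (u y, twoFormCurry (β y.1) (u y) - fderiv ℝ F y ∘L ContinuousLinearMap.inl ℝ E (E →L[ℝ] ℝ))

omit [I.Boundaryless] in
theorem contDiffAt_localHamiltonianField {β : E → E [⋀^Fin 2]→L[ℝ] ℝ} {F : E × (E →L[ℝ] ℝ) → ℝ}
    {u : E × (E →L[ℝ] ℝ) → E} {y : E × (E →L[ℝ] ℝ)} (hβ : ContDiffAt ℝ ∞ β y.1)
    (hF : ContDiffAt ℝ ∞ F y) (hu : ContDiffAt ℝ ∞ u y) :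
    ContDiffAt ℝ ∞ (localHamiltonianField β F u) y := by
  refine hu.prodMk (ContDiffAt.sub ?_ ?_)
  · exact (twoFormCurry.contDiff.contDiffAt.comp y (hβ.comp y contDiffAt_fst)).clm_apply hu
  · exact (hF.fderiv_right (m := ∞) (by norm_cast)).clm_comp contDiffAt_const

theorem twistedForm_localHamiltonianField (B : DForm I M 2) {α : Cotangent I M}
    {F : E × (E →L[ℝ] ℝ) → ℝ} {u : E × (E →L[ℝ] ℝ) → E} {y : E × (E →L[ℝ] ℝ)}
    (hy : y ∈ (extChartAt (cotangentModel I) α).target)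
    (hu : ∀ η, fderiv ℝ F y (0, η) = η (u y)) (z : E × (E →L[ℝ] ℝ)) :
    (twistedForm B).inChart α y ![localHamiltonianField (B.inChart α.proj) F u y, z] =
      fderiv ℝ F y z := by
  have hz : z = (z.1, 0) + (0, z.2) := by simp
  rw [twistedForm_inChart_apply B hy, hz, map_add, hu, ← hz]
  simp only [localHamiltonianField, sub_apply, twoFormCurry_apply]
  change z.2 (u y) - (_ - fderiv ℝ F y (z.1, 0)) + _ = _
  ring

/-- A function on the cotangent bundle has a Hamiltonian vector field if its derivatives along the
fibres are represented by vectors that depend smoothly on the point. -/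
theorem mem_hamiltonianFunctions_of_fiberDeriv {B : DForm I M 2} (hB : B.IsSmooth)
    (F : SFun (cotangentModel I) (Cotangent I M)) (u : Cotangent I M → E × (E →L[ℝ] ℝ) → E)
    (hu : ∀ α, ContDiffAt ℝ ∞ (u α) (extChartAt (cotangentModel I) α α))
    (h : ∀ α, ∀ y ∈ (extChartAt (cotangentModel I) α).target, ∀ η,
      fderiv ℝ (F.inChart α) y (0, η) = η (u α y)) :
    F ∈ hamiltonianFunctions (twistedForm B) := by
  let v (α : Cotangent I M) : E × (E →L[ℝ] ℝ) → E × (E →L[ℝ] ℝ) :=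
    localHamiltonianField (B.inChart α.proj) (F.inChart α) (u α)
  have hv (α : Cotangent I M) : ContDiffAt ℝ ∞ (v α) (extChartAt (cotangentModel I) α α) := by
    refine contDiffAt_localHamiltonianField ?_ (F.contDiffAt_inChart (mem_extChartAt_target α))
      (hu α)
    rw [cotangent_chart_fst]
    exact (hB _).contDiffAt (extChartAt_target_mem_nhds _)
  -- The field is defined pointwise, each value being computed in the chart centred at that point.
  let X (α : Cotangent I M) : TangentSpace (cotangentModel I) α :=
    v α (extChartAt (cotangentModel I) α α)
  have hX (α : Cotangent I M) (Y : TangentSpace (cotangentModel I) α) :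
      twistedForm B α ![X α, Y] = mfderiv (cotangentModel I) 𝓘(ℝ, ℝ) F α Y := by
    revert Y
    refine (hamiltonian_eq_iff_inChart (twistedForm B) F (mem_extChartAt_source α) (X α)).2 ?_
    rw [chartDeriv_self]
    exact twistedForm_localHamiltonianField B (mem_extChartAt_target α)
      (h α _ (mem_extChartAt_target α))
  -- At a nearby `β`, the value computed in the chart at `β` and the local solution `v α` solve the
  -- same equation in the chart at `α`; nondegeneracy identifies them.
  have hsmooth := contMDiff_section_of_inChart X v hv fun α => by
    filter_upwards [extChartAt_source_mem_nhds (I := cotangentModel I) α] with β hβ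
    have hy := (extChartAt (cotangentModel I) α).map_source hβ
    refine twistedForm_inChart_nondegenerate B hy fun z => ?_
    rw [(hamiltonian_eq_iff_inChart (twistedForm B) F hβ (X β)).1 (hX β) z]
    exact (twistedForm_localHamiltonianField B hy (h α _ hy) z).symm
  exact ⟨⟨X, hsmooth⟩, hX⟩

theorem hamiltonianFunctions_eq_top [FiniteDimensional ℝ E] {B : DForm I M 2} (hB : B.IsSmooth) :
    hamiltonianFunctions (twistedForm B) = ⊤ := by
  rw [eq_top_iff]
  intro F _
  let b := Module.finBasis ℝ E
  let e (i) : E →L[ℝ] ℝ := LinearMap.toContinuousLinearMap (b.coord i)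
  -- Reflexivity of `E`, made explicit: in a basis `b` with dual basis `e`, the representing vector
  -- has the derivatives of `F` along the `e i` as coordinates.
  refine mem_hamiltonianFunctions_of_fiberDeriv hB F
    (fun α y => ∑ i, fderiv ℝ (F.inChart α) y (0, e i) • b i) (fun α => ?_) fun α y _ η => ?_
  · refine ContDiffAt.sum fun i _ => ContDiffAt.smul ?_ contDiffAt_const
    exact ((F.contDiffAt_inChart (mem_extChartAt_target α)).fderiv_right (m := ∞)
      (by norm_cast)).clm_apply contDiffAt_const
  · have hη : η = ∑ i, η (b i) • e i := by
      ext c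
      conv_lhs => rw [← b.sum_repr c]
      simp [e, mul_comm, -Module.Basis.sum_repr]
    have h0 : ((0, η) : E × (E →L[ℝ] ℝ)) =
        ∑ i, η (b i) • ContinuousLinearMap.inr ℝ E (E →L[ℝ] ℝ) (e i) := by
      conv_lhs => rw [hη]
      simp only [← map_smul, ← map_sum]
      rfl
    rw [h0, map_sum, map_sum]
    refine Finset.sum_congr rfl fun i _ => ?_
    rw [map_smul, map_smul, smul_eq_mul, smul_eq_mul, mul_comm]
    rfl

end HamiltonianFunctions

/-! ### The map `v + f ↦ ev_v + p^*f` and its compatibility with the brackets. -/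

section EvalMap

variable {E : Type*} [NormedAddCommGroup E] [NormedSpace ℝ E]
  {H : Type*} [TopologicalSpace H] {I : ModelWithCorners ℝ E H}
  {M : Type*} [TopologicalSpace M] [ChartedSpace H M] [IsManifold I ∞ M]

theorem evalMap_apply (a : VField I M × SFun I M) (β : Cotangent I M) :
    evalMap I M a β = Cotangent.covector β (a.1.vec β.proj) + a.2 β.proj := rfl

/-- The zero covector isolates `f`; the remaining covectors then separate the values of `v` by
Hahn-Banach. -/
theorem evalMap_injective : Function.Injective (evalMap I M) := by
  refine (injective_iff_map_eq_zero _).2 fun a ha => ?_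
  have h (x : M) (ξ : E →L[ℝ] ℝ) : ξ (a.1.vec x) + a.2 x = 0 := by
    have := evalMap_apply a (TotalSpace.mk x ξ)
    rw [ha] at this
    exact this.symm
  have h2 (x : M) : a.2 x = 0 := by simpa using h x 0
  have h1 (x : M) : a.1.vec x = 0 :=
    (SeparatingDual.eq_zero_iff_forall_dual_eq_zero (R := ℝ) _).2 fun ξ => by simpa [h2] using h x ξ
  refine Prod.ext ?_ ?_
  · ext x
    exact h1 x
  · ext x
    exact h2 x

variable [I.Boundaryless]

omit [I.Boundaryless] in
theorem evalMap_inChart (a : VField I M × SFun I M) {α : Cotangent I M} {y : E × (E →L[ℝ] ℝ)}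
    (hy : y ∈ (extChartAt (cotangentModel I) α).target) :
    (evalMap I M a).inChart α y = y.2 (a.1.inChart α.proj y.1) + a.2.inChart α.proj y.1 := by
  have hs := (extChartAt (cotangentModel I) α).map_target hy
  rw [SFun.inChart, evalMap_apply, ← cotangent_chart_snd (cotangent_mem_source.1 hs),
    (extChartAt (cotangentModel I) α).right_inv hy, ← a.1.inChart_extChartAt
      (cotangent_mem_source.1 hs), ← cotangent_chart_fst,
    (extChartAt (cotangentModel I) α).right_inv hy, SFun.inChart, cotangent_chart_symm_proj hy]

/-- The function is affine along each fibre. Differentiating along a line in the fibre needs no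
differentiability of the local expression of `v`, which is at hand only at the centre. -/
theorem fderiv_evalMap_inChart_fiber (a : VField I M × SFun I M) {α : Cotangent I M}
    {y : E × (E →L[ℝ] ℝ)} (hy : y ∈ (extChartAt (cotangentModel I) α).target) (η : E →L[ℝ] ℝ) :
    fderiv ℝ ((evalMap I M a).inChart α) y (0, η) = η (a.1.inChart α.proj y.1) := by
  have hd : DifferentiableAt ℝ ((evalMap I M a).inChart α) y :=
    ((evalMap I M a).contDiffAt_inChart hy).differentiableAt (by simp)
  have h0 : HasDerivAt (fun t : ℝ => y + t • ((0, η) : E × (E →L[ℝ] ℝ))) (0, η) 0 := by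
    simpa using ((hasDerivAt_id (0 : ℝ)).smul_const ((0, η) : E × (E →L[ℝ] ℝ))).const_add y
  have h1 : HasDerivAt (fun t : ℝ => (evalMap I M a).inChart α (y + t • (0, η)))
      (fderiv ℝ ((evalMap I M a).inChart α) y (0, η)) 0 := by
    have h := hd.hasFDerivAt
    rw [← add_zero y, ← zero_smul ℝ ((0, η) : E × (E →L[ℝ] ℝ))] at h
    have h' := h.comp_hasDerivAt 0 h0
    rw [zero_smul, add_zero] at h'
    exact h'
  have h2 : HasDerivAt (fun t : ℝ => y.2 (a.1.inChart α.proj y.1) + t * η (a.1.inChart α.proj y.1) +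
      a.2.inChart α.proj y.1) (η (a.1.inChart α.proj y.1)) 0 := by
    simpa using (((hasDerivAt_id (0 : ℝ)).mul_const (η (a.1.inChart α.proj y.1))).const_add
      (y.2 (a.1.inChart α.proj y.1))).add_const (a.2.inChart α.proj y.1)
  refine h1.unique (h2.congr_of_eventuallyEq (Filter.Eventually.of_forall fun t => ?_))
  have ht : y + t • ((0, η) : E × (E →L[ℝ] ℝ)) = (y.1, y.2 + t • η) := by
    ext <;> simp
  have hy' : (y.1, y.2 + t • η) ∈ (extChartAt (cotangentModel I) α).target :=
    cotangent_mem_target.2 (cotangent_mem_target.1 hy)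
  simp only
  rw [ht, evalMap_inChart a hy']
  simp

theorem evalMap_mem_hamiltonianFunctions {B : DForm I M 2} (hB : B.IsSmooth)
    (a : VField I M × SFun I M) : evalMap I M a ∈ hamiltonianFunctions (twistedForm B) := by
  refine mem_hamiltonianFunctions_of_fiberDeriv hB _ (fun α y => a.1.inChart α.proj y.1)
    (fun α => ?_) fun α y hy η => fderiv_evalMap_inChart_fiber a hy η
  have h := a.1.contDiffAt_inChart α.proj
  rw [← cotangent_chart_fst] at h
  exact h.comp (extChartAt (cotangentModel I) α α) contDiffAt_fst

theorem fderiv_evalMap_inChart (a : VField I M × SFun I M) (α : Cotangent I M)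
    (z : E × (E →L[ℝ] ℝ)) :
    fderiv ℝ ((evalMap I M a).inChart α) (extChartAt (cotangentModel I) α α) z =
      z.2 (a.1.vec α.proj) + Cotangent.covector α
        (fderiv ℝ (a.1.inChart α.proj) (extChartAt I α.proj α.proj) z.1) +
      a.2.differential α.proj z.1 := by
  obtain ⟨y, hy⟩ : ∃ y, y = extChartAt (cotangentModel I) α α := ⟨_, rfl⟩
  have hy1 : y.1 = extChartAt I α.proj α.proj := by rw [hy, cotangent_chart_fst]
  have hy2 : y.2 = Cotangent.covector α := by
    ext c
    rw [hy, ← cotangent_chart_snd (mem_extChartAt_source _) c, chartDeriv_self]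
    rfl
  have hv : HasFDerivAt (fun y : E × (E →L[ℝ] ℝ) => a.1.inChart α.proj y.1)
      (fderiv ℝ (a.1.inChart α.proj) y.1 ∘L ContinuousLinearMap.fst ℝ E (E →L[ℝ] ℝ)) y := by
    have h := ((a.1.contDiffAt_inChart α.proj).differentiableAt (by simp)).hasFDerivAt
    rw [← hy1] at h
    exact h.comp y (ContinuousLinearMap.fst ℝ E (E →L[ℝ] ℝ)).hasFDerivAt
  have hf : HasFDerivAt (fun y : E × (E →L[ℝ] ℝ) => a.2.inChart α.proj y.1)
      (fderiv ℝ (a.2.inChart α.proj) y.1 ∘L ContinuousLinearMap.fst ℝ E (E →L[ℝ] ℝ)) y := by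
    have h := ((a.2.contDiffAt_inChart (mem_extChartAt_target α.proj)).differentiableAt
      (by simp)).hasFDerivAt
    rw [← hy1] at h
    exact h.comp y (ContinuousLinearMap.fst ℝ E (E →L[ℝ] ℝ)).hasFDerivAt
  have h := (((hasFDerivAt_snd (p := y) (𝕜 := ℝ)).clm_apply hv).add hf)
  have e : (evalMap I M a).inChart α =ᶠ[𝓝 y]
      (fun y => y.2 (a.1.inChart α.proj y.1)) + fun y => a.2.inChart α.proj y.1 := by
    rw [hy]
    filter_upwards [extChartAt_target_mem_nhds α] with y hy
    exact evalMap_inChart a hy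
  have h3 : a.1.inChart α.proj y.1 = a.1.vec α.proj := by rw [hy1, VField.inChart_self]
  rw [← hy, e.fderiv_eq, SFun.differential_self, ← hy1, ← hy2, ← h3]
  have h4 := DFunLike.congr_fun h.fderiv z
  refine h4.trans ?_
  simp
  ring

variable [CompleteSpace E]

/-- `evalMap` intertwines the bracket of the extension and the Poisson bracket. -/
theorem evalMap_extensionBracket {B : DForm I M 2} (hB : B.IsSmooth)
    (a b : VField I M × SFun I M) {X : VField (cotangentModel I) (Cotangent I M)}
    (hX : IsHamiltonian (twistedForm B) X (evalMap I M a)) :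
    evalMap I M (extensionBracket B hB a b) = (evalMap I M b).lieDeriv X := by
  ext α
  have hX' (z : E × (E →L[ℝ] ℝ)) :=
    (hX.inChart α (mem_extChartAt_target α) z).trans (fderiv_evalMap_inChart a α z)
  rw [X.inChart_self] at hX'
  obtain ⟨ξ, hξ⟩ : ∃ ξ, ξ = X.vec α := ⟨_, rfl⟩
  simp only [twistedForm_inChart_apply B (mem_extChartAt_target α), ← hξ, cotangent_chart_fst]
    at hX'
  have h0 : B.inChart α.proj (extChartAt I α.proj α.proj) ![ξ.1, 0] = 0 :=
    (B.inChart α.proj (extChartAt I α.proj α.proj)).map_coord_zero 1 rfl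
  -- Testing on vertical vectors `(0, η)`: the Hamiltonian field projects to `v`.
  have h1 : ξ.1 = a.1.vec α.proj :=
    (SeparatingDual.eq_iff_forall_dual_eq (R := ℝ)).2 fun η => by
      have h := hX' (0, η)
      simp only [h0] at h
      simpa using h
  -- Testing on `(w, 0)` gives `ξ.2 w = B(v, w) - α(Dv w) - df(w)`. In `L_X (ev_w + p^*g)` the term
  -- `-α(Dv w)` joins `α(Dw v)` to form `α([v, w])`.
  have h2 := hX' (b.1.vec α.proj, 0)
  have hb := B.inChart_eq (mem_extChartAt_source (I := I) α.proj) (a.1.vec α.proj)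
    (b.1.vec α.proj)
  rw [chartDeriv_self, ContinuousLinearMap.id_apply, ContinuousLinearMap.id_apply] at hb
  simp only [h1, ← hb] at h2
  rw [SFun.lieDeriv_apply, SFun.differential_self, fderiv_evalMap_inChart, ← hξ, h1,
    evalMap_apply]
  have e1 : (extensionBracket B hB a b).1.vec α.proj = (a.1.bracket b.1).vec α.proj := rfl
  have e2 : (extensionBracket B hB a b).2 α.proj =
      b.2.differential α.proj (a.1.vec α.proj) - a.2.differential α.proj (b.1.vec α.proj) +
      B.form α.proj ![a.1.vec α.proj, b.1.vec α.proj] := rfl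
  rw [e1, e2, VField.bracket_apply, map_sub, VField.inChart_self, VField.inChart_self]
  simp only [zero_apply, zero_sub, zero_add] at h2
  linarith

end EvalMap

theorem IsLieBracket.of_injective {V W : Type*} [AddCommGroup V] [Module ℝ V] [AddCommGroup W]
    [Module ℝ W] {br : V → V → V} {br' : W → W → W} (h : IsLieBracket br') (Φ : V →ₗ[ℝ] W)
    (hΦ : Function.Injective Φ) (hbr : ∀ a b, Φ (br a b) = br' (Φ a) (Φ b)) : IsLieBracket br where
  add_left a b c := hΦ (by simp only [hbr, map_add, h.add_left])
  smul_left r a b := hΦ (by simp only [hbr, map_smul, h.smul_left])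
  add_right a b c := hΦ (by simp only [hbr, map_add, h.add_right])
  smul_right r a b := hΦ (by simp only [hbr, map_smul, h.smul_right])
  self a := hΦ (by rw [hbr, h.self, map_zero])
  jacobi a b c := hΦ (by simp only [hbr, map_add, map_zero, h.jacobi])

end TwistedCotangent

theorem proposition4p5
    {E : Type*} [NormedAddCommGroup E] [NormedSpace ℝ E] [CompleteSpace E]
    {H : Type*} [TopologicalSpace H] (I : ModelWithCorners ℝ E H) [I.Boundaryless]
    (M : Type*) [TopologicalSpace M] [ChartedSpace H M] [IsManifold I ∞ M]
    (B : TwistedCotangent.DForm I M 2) (hB : B.IsSmooth) (hdB : B.d = 0) :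
    TwistedCotangent.IsLieBracket (TwistedCotangent.extensionBracket B hB) ∧
    (∃ br : TwistedCotangent.hamiltonianFunctions (TwistedCotangent.twistedForm B) →
        TwistedCotangent.hamiltonianFunctions (TwistedCotangent.twistedForm B) →
        TwistedCotangent.hamiltonianFunctions (TwistedCotangent.twistedForm B),
      (∀ F G, ⇑(br F G).1 =
        TwistedCotangent.poissonBracket (TwistedCotangent.twistedForm B) F G) ∧
      TwistedCotangent.IsLieBracket br ∧
      ∃ h : ∀ a, TwistedCotangent.evalMap I M a ∈
          TwistedCotangent.hamiltonianFunctions (TwistedCotangent.twistedForm B),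
        ∀ a b, (⟨TwistedCotangent.evalMap I M (TwistedCotangent.extensionBracket B hB a b), h _⟩ :
            TwistedCotangent.hamiltonianFunctions (TwistedCotangent.twistedForm B)) =
          br ⟨TwistedCotangent.evalMap I M a, h a⟩ ⟨TwistedCotangent.evalMap I M b, h b⟩) ∧
    Function.Injective (TwistedCotangent.evalMap I M) ∧
    (FiniteDimensional ℝ E →
      TwistedCotangent.hamiltonianFunctions (TwistedCotangent.twistedForm B) = ⊤) := by
  have hΩ := TwistedCotangent.isClosedAtCentres_twistedForm hB hdB
  have hmem := TwistedCotangent.evalMap_mem_hamiltonianFunctions (I := I) (M := M) hB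
  have hbr := TwistedCotangent.isLieBracket_poissonBr (TwistedCotangent.twistedForm B) hΩ
  have hhom (a b) : (⟨TwistedCotangent.evalMap I M (TwistedCotangent.extensionBracket B hB a b),
      hmem _⟩ : TwistedCotangent.hamiltonianFunctions (TwistedCotangent.twistedForm B)) =
      TwistedCotangent.poissonBr _ hΩ ⟨TwistedCotangent.evalMap I M a, hmem a⟩
        ⟨TwistedCotangent.evalMap I M b, hmem b⟩ :=
    Subtype.ext (TwistedCotangent.evalMap_extensionBracket hB a b
      (TwistedCotangent.isHamiltonian_hamiltonianField _ ⟨_, hmem a⟩))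
  refine ⟨?_, ⟨TwistedCotangent.poissonBr _ hΩ, TwistedCotangent.coe_poissonBr _ hΩ, hbr, hmem,
    hhom⟩, TwistedCotangent.evalMap_injective,
    fun _ => TwistedCotangent.hamiltonianFunctions_eq_top hB⟩
  -- The Jacobi identity of the extension, where closedness of `B` is essential, is read off from
  -- the Poisson algebra.
  exact hbr.of_injective ((TwistedCotangent.evalMap I M).codRestrict _ hmem)
    (fun a b h => TwistedCotangent.evalMap_injective (congrArg Subtype.val h)) hhom
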